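/- Let $a_1,\dots,a_n\in\mathbb R^2$ be pairwise distinct, let $D\subset\mathbb R^2$ be a convex compact polygon with nonempty interior, let $g\in C^2(\mathbb R^n)$ and $\alpha>0$, and let $u_d$ be a nonnegative measure on $D$ with a Lebesgue density $\varrho$ that is continuous (and nonnegative) on $D$. For $\xi\in\mathbb R^n$ put \[ D_i(\xi)=\{x\in\operatorname{int}D : a_i^\top x-\xi_i>a_j^\top x-\xi_j\ \forall j\neq i\},\qquad \tilde u(\xi)=\bigl(u_d(D_1(\xi)),\dots,u_d(D_n(\xi))\bigr)^\top , \] \[ W(\xi)=W_2^2\Bigl(u_d,\sum_{i=1}^n\tilde u_i(\xi)\delta_{a_i}\Bigr),\quad J(\xi)=g(\tilde u(\xi))+\tfrac\alpha2W(\xi),\quad A=\tfrac12(|a_1|^2,\dots,|a_n|^2)^\top,\quad r(\xi)=A+\tfrac1\alpha\nabla g(\tilde u(\xi))-\xi , \] where $W_2^2(\mu,\nu)$ is the infimum of $\int|x-y|^2\,d\gamma(x,y)$ over all couplings $\gamma\ge0$ of $\mu$ and $\nu$. Let $\Theta(\xi)\in\mathbb R^{n\times n}$ be the following matrix. If $u_d(D_i(\xi))=0$,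 the $i$-th row of $\Theta(\xi)$ is zero. If $u_d(D_i(\xi))>0$, then for $k\ne i$ \[ \Theta_{ik}(\xi)=\frac1{|a_k-a_i|}\int_{\overline{D_i(\xi)}\cap\overline{D_k(\xi)}}\varrho\,d\mathcal H^1 \] if $D_i(\xi)$ and $D_k(\xi)$ share an edge (that is, the closures meet in more than one point), $\Theta_{ik}(\xi)=0$ otherwise, and $\Theta_{ii}(\xi)=-\sum_{k\neq i}\Theta_{ik}(\xi)$. For a locally Lipschitz $f:\mathbb R^n\to\mathbb R^m$ let Clarke's generalized Jacobian $\partial^Cf(x)$ be the convex hull of all limits $\lim_k f'(x_k)$ along sequences $x_k\to x$ of points at which $f$ is differentiable. A function $f$ is called $PC^1$ if it is continuous and every point has an open neighborhood $U$ with finitely many $C^1$ functions $f^1,\dots,f^N$ on $U$ such that $f(x)\in\{f^1(x),\dots,f^N(x)\}$ for all $x\in U$. It is called semismooth if, for every $x$, it is Lipschitz continuous near $x$, all one-sided directional derivatives $f'(x;y)$ exist, and $\sup_{M\in\partial^Cf(x+s)}|f(x+s)-f(x)-Ms|=o(|s|)$ as $s\to0$. Then $J$, $r$, $\tilde u$ and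 $W$ are $PC^1$ and semismooth. Moreover, for all $\xi\in\mathbb R^n$, \[ \Theta(\xi)\in\partial^C\tilde u(\xi),\qquad \tfrac1\alpha\nabla^2g(\tilde u(\xi))\,\Theta(\xi)-I\in\partial^Cr(\xi), \] \[ 2(A-\xi)^\top\Theta(\xi)\in\partial^CW(\xi),\qquad \alpha\,r(\xi)^\top\Theta(\xi)\in\partial^CJ(\xi). \] -/

import Mathlib

open Set Filter Topology MeasureTheory

noncomputable section

namespace SemiDiscreteOT

/-- The Euclidean plane. -/
abbrev Plane := EuclideanSpace ℝ (Fin 2)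

/-- `ℝⁿ` with the Euclidean norm. -/
abbrev Vec (n : ℕ) := EuclideanSpace ℝ (Fin n)

/-! ### Generalized differentiability -/

section Differentiability

variable {E F : Type*} [NormedAddCommGroup E] [NormedSpace ℝ E]
  [NormedAddCommGroup F] [NormedSpace ℝ F]

/-- `f` is `PC¹`: it is continuous and locally a selection of finitely many `C¹` functions. -/
def IsPC1 (f : E → F) : Prop :=
  Continuous f ∧ ∀ x₀ : E, ∃ U : Set E, IsOpen U ∧ x₀ ∈ U ∧
    ∃ (N : ℕ) (φ : Fin N → E → F), (∀ i, ContDiffOn ℝ 1 (φ i) U) ∧ ∀ x ∈ U, ∃ i, f x = φ i x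

/-- Clarke's generalized Jacobian: the convex hull of all limits of derivatives `f'(x_k)` along
sequences `x_k → x` of points of differentiability. Matrices are identified with linear maps. -/
def clarkeJacobian (f : E → F) (x : E) : Set (E →L[ℝ] F) :=
  convexHull ℝ {M | ∃ y : ℕ → E, (∀ k, DifferentiableAt ℝ f (y k)) ∧
    Tendsto y atTop (𝓝 x) ∧ Tendsto (fun k => fderiv ℝ f (y k)) atTop (𝓝 M)}

/-- `f` is semismooth: at every `x`, it is Lipschitz near `x`, all one-sided directional derivatives
exist, and `sup_{M ∈ ∂f(x+s)} |f(x+s) - f(x) - M s| = o(|s|)` as `s → 0`. -/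
def IsSemismooth (f : E → F) : Prop :=
  ∀ x : E,
    (∃ K : NNReal, ∃ U ∈ 𝓝 x, LipschitzOnWith K f U) ∧
    (∀ y : E, ∃ d : F, Tendsto (fun t : ℝ => t⁻¹ • (f (x + t • y) - f x)) (𝓝[>] 0) (𝓝 d)) ∧
    (∀ ε : ℝ, 0 < ε → ∀ᶠ s in 𝓝 (0 : E), ∀ M ∈ clarkeJacobian f (x + s),
      ‖f (x + s) - f x - M s‖ ≤ ε * ‖s‖)

end Differentiability

/-! ### The transport problem -/

/-- A convex compact polygon with nonempty interior. -/
def IsConvexPolygon (D : Set Plane) : Prop :=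
  (∃ S : Finset Plane, D = convexHull ℝ (S : Set Plane)) ∧ (interior D).Nonempty

/-- The measure on `D` with Lebesgue density `ρ`. -/
def densityMeasure (D : Set Plane) (ρ : Plane → ℝ) : Measure Plane :=
  (volume.restrict D).withDensity fun x => ENNReal.ofReal (ρ x)

/-- The couplings of `μ` and `ν`. -/
def couplings (μ ν : Measure Plane) : Set (Measure (Plane × Plane)) :=
  {γ | γ.map Prod.fst = μ ∧ γ.map Prod.snd = ν}

/-- The squared quadratic Monge-Kantorovich distance (`⊤` if there is no coupling). -/
def mongeKantorovichSq (μ ν : Measure Plane) : ENNReal :=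
  ⨅ γ ∈ couplings μ ν, ∫⁻ z, ENNReal.ofReal (‖z.1 - z.2‖ ^ 2) ∂γ

variable {n : ℕ}

/-- The dominating region `D_i(ξ)`. -/
def region (D : Set Plane) (a : Fin n → Plane) (ξ : Vec n) (i : Fin n) : Set Plane :=
  {x ∈ interior D | ∀ j, j ≠ i → inner ℝ (a j) x - ξ j < inner ℝ (a i) x - ξ i}

/-- The vector `ũ(ξ)` of the masses of the dominating regions. -/
def massVec (D : Set Plane) (ρ : Plane → ℝ) (a : Fin n → Plane) (ξ : Vec n) : Vec n :=
  WithLp.toLp 2 fun i => (densityMeasure D ρ).real (region D a ξ i)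

/-- The measure `∑ᵢ ũᵢ(ξ) δ_{aᵢ}` that is identified with the vector `ũ(ξ)`. -/
def massMeasure (D : Set Plane) (ρ : Plane → ℝ) (a : Fin n → Plane) (ξ : Vec n) : Measure Plane :=
  ∑ i, densityMeasure D ρ (region D a ξ i) • Measure.dirac (a i)

/-- `W(ξ) = W₂²(u_d, ũ(ξ))`. -/
def transportCost (D : Set Plane) (ρ : Plane → ℝ) (a : Fin n → Plane) (ξ : Vec n) : ℝ :=
  (mongeKantorovichSq (densityMeasure D ρ) (massMeasure D ρ a ξ)).toReal

/-- `J(ξ) = g(ũ(ξ)) + (α / 2) W(ξ)`. -/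
def objective (D : Set Plane) (ρ : Plane → ℝ) (a : Fin n → Plane) (g : Vec n → ℝ) (α : ℝ)
    (ξ : Vec n) : ℝ :=
  g (massVec D ρ a ξ) + α / 2 * transportCost D ρ a ξ

/-- The vector `A = ½ (|a₁|², …, |aₙ|²)`. -/
def halfSq (a : Fin n → Plane) : Vec n :=
  WithLp.toLp 2 fun i => ‖a i‖ ^ 2 / 2

/-- `r(ξ) = A + (1 / α) ∇g(ũ(ξ)) - ξ`. -/
def residual (D : Set Plane) (ρ : Plane → ℝ) (a : Fin n → Plane) (g : Vec n → ℝ) (α : ℝ)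
    (ξ : Vec n) : Vec n :=
  halfSq a + (1 / α) • gradient g (massVec D ρ a ξ) - ξ

/-- The Hessian `∇²g(v)`, as a linear map. -/
def hessian (g : Vec n → ℝ) (v : Vec n) : Vec n →L[ℝ] Vec n :=
  fderiv ℝ (gradient g) v

/-- The common boundary of the regions `D_i(ξ)` and `D_j(ξ)`. -/
def commonBoundary (D : Set Plane) (a : Fin n → Plane) (ξ : Vec n) (i j : Fin n) : Set Plane :=
  closure (region D a ξ i) ∩ closure (region D a ξ j)

/-- The regions `D_i(ξ)` and `D_j(ξ)` share an edge. For `i ≠ j` the common boundary is a compact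
convex subset of a line, hence a nondegenerate segment as soon as it has two points. -/
def ShareEdge (D : Set Plane) (a : Fin n → Plane) (ξ : Vec n) (i j : Fin n) : Prop :=
  i ≠ j ∧ (commonBoundary D a ξ i j).Nontrivial

/-- The integral of `ρ` over the edge between `D_i(ξ)` and `D_j(ξ)` with respect to the
one-dimensional Hausdorff measure, divided by `|a_j - a_i|`. -/
def edgeWeight (D : Set Plane) (ρ : Plane → ℝ) (a : Fin n → Plane) (ξ : Vec n)
    (i j : Fin n) : ℝ :=
  1 / ‖a j - a i‖ * ∫ x in commonBoundary D a ξ i j, ρ x ∂(Measure.hausdorffMeasure 1)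

open Classical in
/-- The edge-length matrix `Θ(ξ)`. -/
def edgeMatrix (D : Set Plane) (ρ : Plane → ℝ) (a : Fin n → Plane) (ξ : Vec n) :
    Matrix (Fin n) (Fin n) ℝ :=
  Matrix.of fun i k =>
    if 0 < densityMeasure D ρ (region D a ξ i) then
      if k = i then -∑ j with ShareEdge D a ξ i j, edgeWeight D ρ a ξ i j
      else if ShareEdge D a ξ i k then edgeWeight D ρ a ξ i k
      else 0
    else 0

/-- `Θ(ξ)` as a linear map. -/
def edgeMap (D : Set Plane) (ρ : Plane → ℝ) (a : Fin n → Plane) (ξ : Vec n) :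
    Vec n →L[ℝ] Vec n :=
  Matrix.toEuclideanCLM (𝕜 := ℝ) (edgeMatrix D ρ a ξ)

/-- The linear form `x ↦ vᵀ x`, i.e. the row vector `vᵀ`. -/
def row (v : Vec n) : Vec n →L[ℝ] ℝ :=
  innerSL ℝ v

end SemiDiscreteOT

end

/-! All the nonsmoothness sits in `massVec`. The coupling that sends each region to its point is
optimal by Kantorovich duality with the potential max_i (⟨a_i, x⟩ - ξ_i). This gives W(ξ) = -2 K(ξ)
+ 2⟨A - ξ, ũ(ξ)⟩ with K of class C¹ and ∇K = -ũ (`transportCost_eq`,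
`hasFDerivAt_integral_potential`). Hence r, W and J all have the form Ψ(ξ, ũ(ξ)) with Ψ of class C¹,
and it suffices to understand ũ (`IsPC1.comp_graph`, `comp_graph_mem_clarkeJacobian`).
Semismoothness is a general consequence of PC¹ (`IsPC1.isSemismooth`).

ũ is PC¹: up to a null set a region is a polygon with fixed normals and offsets affine in ξ. Slicing
it along a coordinate axis writes its mass as a signed sum of integrals of a primitive of the
density along single bounding lines. Each is taken over an interval whose endpoints are selected
among finitely many affine functions of ξ, and every choice of endpoints gives a C¹ function
(`isC1Selection_halfplanes`).

Θ(ξ) is a generalized derivative: moving one edge of a polygon changes the integral at the rate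
(edge integral)/(length of the normal), provided no two constraint lines coincide. Lines that
separate nonempty regions never coincide (`not_coincident`), but an empty region may contribute a
bad line. Raising ξ_i by τ > 0 exactly for the empty regions makes their scores strictly dominated
and leaves the closures of the nonempty regions unchanged. So ũ is differentiable at the perturbed
point with derivative exactly Θ(ξ) (`hasFDerivAt_massVec_perturb`), and τ → 0 gives the claim. The
chain rule at the same points yields the other three inclusions. -/

namespace SemiDiscreteOT

/-! ### Piecewise C¹ functions: Lipschitz continuity, semismoothness, generalized Jacobians. -/

section PiecewiseC1

variable {E F G : Type*} [NormedAddCommGroup E] [NormedSpace ℝ E]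
  [NormedAddCommGroup F] [NormedSpace ℝ F] [NormedAddCommGroup G] [NormedSpace ℝ G]

/-- Pigeonhole along a filter. It provides a single selection function that is active along a whole
sequence. -/
theorem exists_frequently_of_eventually_exists {X ι : Type*} [Finite ι] {l : Filter X} [l.NeBot]
    {p : ι → X → Prop} (h : ∀ᶠ x in l, ∃ i, p i x) : ∃ i, ∃ᶠ x in l, p i x := by
  by_contra! hc
  obtain ⟨x, ⟨i, hi⟩, hx⟩ := (h.and (eventually_all.2 hc)).exists
  exact hx i hi

/-- A continuous selection of finitely many `K`-Lipschitz curves is `K`-Lipschitz. -/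
theorem norm_sub_le_of_selection {F : Type*} [NormedAddCommGroup F] {N : ℕ} {K : NNReal}
    {q : ℝ → F} {φ : Fin N → ℝ → F}
    (hq : ContinuousOn q (Icc 0 1)) (hφ : ∀ i, LipschitzOnWith K (φ i) (Icc 0 1))
    (hsel : ∀ t ∈ Icc (0 : ℝ) 1, ∃ i, q t = φ i t) : ‖q 1 - q 0‖ ≤ K := by
  -- This mean value principle only asks for slopes below `r` at points arbitrarily close to `x` on
  -- the right. Some fixed `φ i` agrees with `q` at such points, hence by continuity also at `x`,
  -- and its Lipschitz bound controls those slopes.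
  have key := image_le_of_liminf_slope_right_le_deriv_boundary
    (f := fun t => ‖q t - q 0‖) (a := 0) (b := 1) (B := fun t => K * t) (B' := fun _ => K)
    (hq.sub continuousOn_const).norm (by simp) (by fun_prop)
    (fun x _ => by simpa using ((hasDerivAt_id x).const_mul (K : ℝ)).hasDerivWithinAt)
    (fun x hx r hr => by
      have hmem : ∀ᶠ z in 𝓝[>] x, z ∈ Ioc x 1 := Ioc_mem_nhdsGT hx.2
      have hle : 𝓝[>] x ≤ 𝓝[Icc 0 1] x := by
        refine le_inf inf_le_left ?_
        rw [le_principal_iff]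
        filter_upwards [hmem] with z hz using ⟨hx.1.trans hz.1.le, hz.2⟩
      have hxI : x ∈ Icc (0 : ℝ) 1 := ⟨hx.1, hx.2.le⟩
      obtain ⟨i, hi⟩ := exists_frequently_of_eventually_exists (l := 𝓝[>] x)
        (p := fun i z => q z = φ i z)
        (hmem.mono fun z hz => hsel z ⟨hx.1.trans hz.1.le, hz.2⟩)
      have hqx : q x = φ i x := tendsto_nhds_unique_of_frequently_eq
        ((hq x hxI).mono_left hle) (((hφ i).continuousOn x hxI).mono_left hle) hi
      refine (hi.and_eventually hmem).mono ?_
      rintro z ⟨hz, hzx⟩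
      have hzI : z ∈ Icc (0 : ℝ) 1 := ⟨hx.1.trans hzx.1.le, hzx.2⟩
      have h1 : ‖q z - q x‖ ≤ K * (z - x) := by
        have := (hφ i).dist_le_mul z hzI x hxI
        rwa [dist_eq_norm, dist_eq_norm, ← hz, ← hqx, Real.norm_eq_abs,
          abs_of_pos (sub_pos.2 hzx.1)] at this
      have h2 : ‖q z - q 0‖ - ‖q x - q 0‖ ≤ ‖q z - q x‖ := by
        have := norm_sub_norm_le (q z - q 0) (q x - q 0)
        simpa using this
      rw [slope_def_field]
      refine lt_of_le_of_lt ?_ hr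
      rw [div_le_iff₀ (sub_pos.2 hzx.1)]
      exact h2.trans h1)
  simpa using key (right_mem_Icc.2 zero_le_one)

theorem IsPC1.lipschitz_near {f : E → F} (hf : IsPC1 f) (x : E) :
    ∃ K : NNReal, ∃ U ∈ 𝓝 x, LipschitzOnWith K f U := by
  obtain ⟨U, hU, hxU, N, φ, hφ, hsel⟩ := hf.2 x
  have hL : ∀ i, ∃ K : NNReal, ∃ V ∈ 𝓝 x, LipschitzOnWith K (φ i) V := fun i =>
    ((hφ i).contDiffAt (hU.mem_nhds hxU)).exists_lipschitzOnWith
  choose K V hV hKV using hL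
  have hmem : (⋂ i, V i) ∩ U ∈ 𝓝 x := inter_mem (iInter_mem.2 hV) (hU.mem_nhds hxU)
  obtain ⟨r, hr, hball⟩ := Metric.mem_nhds_iff.1 hmem
  -- The sum serves as a common Lipschitz constant for all selection functions. The ball is convex,
  -- so `f` can be restricted to segments.
  refine ⟨∑ i, K i, Metric.ball x r, Metric.ball_mem_nhds x hr, ?_⟩
  refine LipschitzOnWith.of_dist_le_mul fun y hy z hz => ?_
  set γ : ℝ → E := fun t => z + t • (y - z) with hγ
  have hγm : ∀ t ∈ Icc (0 : ℝ) 1, γ t ∈ Metric.ball x r := fun t ht =>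
    (convex_ball x r).add_smul_sub_mem hz hy ht
  have hγL : LipschitzWith ‖y - z‖₊ γ := LipschitzWith.of_dist_le_mul fun s t => by
    rw [dist_eq_norm, dist_eq_norm, coe_nnnorm, mul_comm, ← norm_smul, sub_smul]
    simp [hγ]
  have := norm_sub_le_of_selection (K := (∑ i, K i) * ‖y - z‖₊) (q := f ∘ γ)
    (φ := fun i => φ i ∘ γ) (hf.1.comp hγL.continuous).continuousOn
    (fun i => by
      refine ((LipschitzOnWith.comp ((hKV i).mono ?_) (hγL.lipschitzOnWith (s := Icc 0 1)) hγm)).weaken ?_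
      · exact fun w hw => mem_iInter.1 (hball hw).1 i
      · gcongr
        exact Finset.single_le_sum (f := K) (fun _ _ => zero_le) (Finset.mem_univ i))
    (fun t ht => hsel _ (hball (hγm t ht)).2)
  simpa [hγ, dist_eq_norm] using this

/-- A curve which accumulates only at a finite set converges. -/
theorem exists_tendsto_of_finite_cluster {F : Type*} [NormedAddCommGroup F] {q : ℝ → F} (hq : ContinuousOn q (Ioi 0)) {S : Set F}
    (hS : S.Finite) (h : ∀ ε > 0, ∀ᶠ t in 𝓝[>] (0 : ℝ), ∃ d ∈ S, dist (q t) d < ε) :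
    ∃ d, Tendsto q (𝓝[>] 0) (𝓝 d) := by
  have := hS.to_subtype
  -- Otherwise every point of the finite set `S` is eventually avoided, at a common distance, which
  -- contradicts `h`.
  have hcl : ∃ d ∈ S, ∀ ε > 0, ∃ᶠ t in 𝓝[>] (0 : ℝ), dist (q t) d < ε := by
    by_contra! hc
    choose! ε hε hεq using hc
    have h1 : ∀ᶠ e in 𝓝[>] (0 : ℝ), ∀ d : S, e < ε d := eventually_all.2 fun d =>
      nhdsWithin_le_nhds (Iio_mem_nhds (hε d d.2))
    obtain ⟨e, he, he0⟩ := (h1.and self_mem_nhdsWithin).exists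
    obtain ⟨t, ⟨d, hd, hdt⟩, ht⟩ := ((h e he0).and
      (eventually_all.2 fun d : S => hεq d d.2)).exists
    exact (ht ⟨d, hd⟩).not_gt (hdt.trans (he ⟨d, hd⟩))
  obtain ⟨d, -, hfreq⟩ := hcl
  have hnhds : (S \ {d})ᶜ ∈ 𝓝 d :=
    (hS.subset sdiff_subset).isClosed.isOpen_compl.mem_nhds (by simp)
  obtain ⟨R, hR, hball⟩ := Metric.mem_nhds_iff.1 hnhds
  have hsep : ∀ d' ∈ S, d' ≠ d → R ≤ dist d' d := fun d' hd' hne => by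
    by_contra! hlt
    exact hball (Metric.mem_ball.2 hlt) ⟨hd', hne⟩
  -- Points of `S` other than `d` are at least `3r` away from `d`. A value within `r` of one of them
  -- is therefore outside the closed `r`-ball about `d`, and connectedness confines the curve to the
  -- open `r`-ball.
  set r := R / 3 with hr
  have hr0 : 0 < r := by positivity
  obtain ⟨δ, hδ0, hδ⟩ := mem_nhdsGT_iff_exists_Ioo_subset.1 (h r hr0)
  have hδ0' : (0 : ℝ) < δ := hδ0
  have hpre : IsPreconnected (q '' Ioo 0 δ) :=
    isPreconnected_Ioo.image q (hq.mono Ioo_subset_Ioi_self)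
  have hsub : q '' Ioo 0 δ ⊆ Metric.ball d r := by
    refine hpre.subset_left_of_subset_union (v := (Metric.closedBall d r)ᶜ) Metric.isOpen_ball
      Metric.isClosed_closedBall.isOpen_compl ?_ ?_ ?_
    · exact disjoint_compl_right.mono_left Metric.ball_subset_closedBall
    · rintro _ ⟨t, ht, rfl⟩
      obtain ⟨d', hd', hdist⟩ := hδ ht
      by_cases hdd : d' = d
      · left; rw [← hdd]; exact hdist
      · right
        have h1 := hsep d' hd' hdd
        have h2 := dist_triangle_left d' d (q t)
        simp only [mem_compl_iff, Metric.mem_closedBall, not_le]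
        linarith
    · obtain ⟨t, ht, htδ⟩ := ((hfreq r hr0).and_eventually (Ioo_mem_nhdsGT hδ0')).exists
      exact ⟨q t, ⟨t, htδ, rfl⟩, ht⟩
  refine ⟨d, Metric.tendsto_nhds.2 fun ε hε => ?_⟩
  filter_upwards [h (min ε r) (lt_min hε hr0), Ioo_mem_nhdsGT hδ0'] with t ⟨d', hd', ht⟩ htδ
  have h1 : dist (q t) d < r := hsub ⟨t, htδ, rfl⟩
  have hdd : d' = d := by
    by_contra hne
    have h2 := hsep d' hd' hne
    have h3 := dist_triangle_left d' d (q t)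
    have h4 := ht.trans_le (min_le_right ε r)
    linarith
  exact hdd ▸ ht.trans_le (min_le_left _ _)

/-- The difference quotients are continuous for `t > 0` and accumulate only at the finitely many
directional derivatives of the selection functions, so they cannot oscillate between them. -/
theorem IsPC1.exists_directional_deriv {f : E → F} (hf : IsPC1 f) (x y : E) :
    ∃ d : F, Tendsto (fun t : ℝ => t⁻¹ • (f (x + t • y) - f x)) (𝓝[>] 0) (𝓝 d) := by
  obtain ⟨U, hU, hxU, N, φ, hφ, hsel⟩ := hf.2 x
  have hfd : ∀ i, HasFDerivAt (φ i) (fderiv ℝ (φ i) x) x := fun i =>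
    (((hφ i).contDiffAt (hU.mem_nhds hxU)).differentiableAt one_ne_zero).hasFDerivAt
  have hlim : Tendsto (fun t : ℝ => x + t • y) (𝓝[>] 0) (𝓝 x) := by
    have : Continuous fun t : ℝ => x + t • y := by fun_prop
    simpa using (this.tendsto 0).mono_left nhdsWithin_le_nhds
  refine exists_tendsto_of_finite_cluster (S := range fun i => fderiv ℝ (φ i) x y) ?_
    (finite_range _) fun ε hε => ?_
  · refine ContinuousOn.smul (continuousOn_inv₀.mono fun t ht => ne_of_gt ht) ?_
    exact ((hf.1.comp (by fun_prop)).sub continuous_const).continuousOn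
  -- By continuity, a function active arbitrarily close to `x` is active at `x`. The quotient of `f`
  -- is then a quotient of that `φ i`.
  · have hact : ∀ i, ∀ᶠ t in 𝓝[>] (0 : ℝ), f (x + t • y) = φ i (x + t • y) → f x = φ i x := by
      intro i
      by_cases hi : f x = φ i x
      · exact Eventually.of_forall fun _ _ => hi
      · have h1 := (hf.1.tendsto x).comp hlim
        have h2 := ((hfd i).continuousAt.tendsto).comp hlim
        filter_upwards [(h1.prodMk_nhds h2).eventually
          (isClosed_diagonal.isOpen_compl.mem_nhds (show (f x, φ i x) ∈ (diagonal F)ᶜ from hi))]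
          with t ht h using absurd h ht
    have hslope : ∀ i, ∀ᶠ t in 𝓝[>] (0 : ℝ),
        dist (t⁻¹ • (φ i (x + t • y) - φ i x)) (fderiv ℝ (φ i) x y) < ε := fun i =>
      Metric.tendsto_nhds.1 ((hfd i).hasLineDerivAt y).tendsto_slope_zero_right ε hε
    filter_upwards [eventually_all.2 hact, eventually_all.2 hslope, hlim.eventually (hU.mem_nhds hxU)]
      with t h1 h2 h3
    obtain ⟨i, hi⟩ := hsel _ h3
    refine ⟨_, ⟨i, rfl⟩, ?_⟩
    rw [hi, h1 i hi]
    exact h2 i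

/-- The derivative of a selection is the derivative of an active selection function. -/
theorem fderiv_eq_of_selection {f : E → F} {U : Set E} (hU : IsOpen U) {N : ℕ}
    {φ : Fin N → E → F} (hφ : ∀ i, ContDiffOn ℝ 1 (φ i) U) (hsel : ∀ x ∈ U, ∃ i, f x = φ i x)
    {y : E} (hy : y ∈ U) (hf : DifferentiableAt ℝ f y) :
    ∃ i, f y = φ i y ∧ fderiv ℝ f y = fderiv ℝ (φ i) y := by
  have hfd : ∀ i, HasFDerivAt (φ i) (fderiv ℝ (φ i) y) y := fun i =>
    (((hφ i).contDiffAt (hU.mem_nhds hy)).differentiableAt one_ne_zero).hasFDerivAt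
  have hpt : ∀ v : E, ∃ i, f y = φ i y ∧ fderiv ℝ f y v = fderiv ℝ (φ i) y v := by
    intro v
    have hlim : Tendsto (fun t : ℝ => y + t • v) (𝓝[>] 0) (𝓝 y) := by
      have : Continuous fun t : ℝ => y + t • v := by fun_prop
      simpa using (this.tendsto 0).mono_left nhdsWithin_le_nhds
    obtain ⟨i, hi⟩ := exists_frequently_of_eventually_exists (l := 𝓝[>] (0 : ℝ))
      (p := fun i t => f (y + t • v) = φ i (y + t • v))
      ((hlim.eventually (hU.mem_nhds hy)).mono fun t ht => hsel _ ht)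
    have h0 : f y = φ i y := tendsto_nhds_unique_of_frequently_eq
      (hf.continuousAt.tendsto.comp hlim) ((hfd i).continuousAt.tendsto.comp hlim) hi
    refine ⟨i, h0, tendsto_nhds_unique_of_frequently_eq
      (hf.hasFDerivAt.hasLineDerivAt v).tendsto_slope_zero_right
      ((hfd i).hasLineDerivAt v).tendsto_slope_zero_right (hi.mono fun t ht => ?_)⟩
    rw [ht, h0]
  -- The active index found above depends on the direction. A real vector space is not a finite
  -- union of proper subspaces, so one index works for all directions.
  obtain ⟨⟨i, hi⟩, htop⟩ := Subspace.exists_eq_top_of_iUnion_eq_univ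
    (p := fun i : {i // f y = φ i y} =>
      LinearMap.ker ((fderiv ℝ f y - fderiv ℝ (φ i) y : E →L[ℝ] F) : E →ₗ[ℝ] F))
    (by
      refine eq_univ_of_forall fun v => ?_
      obtain ⟨i, hi, hv⟩ := hpt v
      exact mem_iUnion.2 ⟨⟨i, hi⟩, by simp [hv]⟩)
  refine ⟨i, hi, ?_⟩
  ext v
  have : v ∈ (⊤ : Submodule ℝ E) := trivial
  rw [← htop] at this
  simpa [sub_eq_zero] using this

/-- The estimate is convex in `M`, so only limits of derivatives matter, and such a limit is the
derivative at `x + s` of a function active there. One `ε / 2` pays for its first-order expansion at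
`x`, the other for replacing its derivative at `x` by that at `x + s`. -/
theorem IsPC1.clarkeJacobian_approx {f : E → F} (hf : IsPC1 f) (x : E) {ε : ℝ} (hε : 0 < ε) :
    ∀ᶠ s in 𝓝 (0 : E), ∀ M ∈ clarkeJacobian f (x + s), ‖f (x + s) - f x - M s‖ ≤ ε * ‖s‖ := by
  obtain ⟨U, hU, hxU, N, φ, hφ, hsel⟩ := hf.2 x
  have hc : ∀ i, ContinuousOn (φ i) U := fun i => (hφ i).continuousOn
  have hdc : ∀ i, ContinuousOn (fderiv ℝ (φ i)) U := fun i =>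
    (hφ i).continuousOn_fderiv_of_isOpen hU le_rfl
  have hlim : Tendsto (fun s : E => x + s) (𝓝 0) (𝓝 x) := by
    have : Continuous fun s : E => x + s := by fun_prop
    simpa using this.tendsto 0
  have hact : ∀ i, ∀ᶠ s in 𝓝 (0 : E), f (x + s) = φ i (x + s) → f x = φ i x := by
    intro i
    by_cases hi : f x = φ i x
    · exact Eventually.of_forall fun _ _ => hi
    · have h1 := (hf.1.tendsto x).comp hlim
      have h2 := ((hc i).continuousAt (hU.mem_nhds hxU)).tendsto.comp hlim
      filter_upwards [(h1.prodMk_nhds h2).eventually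
        (isClosed_diagonal.isOpen_compl.mem_nhds (show (f x, φ i x) ∈ (diagonal F)ᶜ from hi))]
        with t ht h using absurd h ht
  have hfirst : ∀ i, ∀ᶠ s in 𝓝 (0 : E),
      ‖φ i (x + s) - φ i x - fderiv ℝ (φ i) x s‖ ≤ ε / 2 * ‖s‖ := fun i => by
    have h := (((hφ i).contDiffAt (hU.mem_nhds hxU)).differentiableAt one_ne_zero).hasFDerivAt
    exact (hasFDerivAt_iff_isLittleO_nhds_zero.1 h).def (half_pos hε)
  have hder : ∀ i, ∀ᶠ s in 𝓝 (0 : E), ‖fderiv ℝ (φ i) (x + s) - fderiv ℝ (φ i) x‖ ≤ ε / 2 :=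
    fun i => by
      have h := ((hdc i).continuousAt (hU.mem_nhds hxU)).tendsto.comp hlim
      filter_upwards [Metric.tendsto_nhds.1 h (ε / 2) (half_pos hε)] with s hs
      rw [← dist_eq_norm]; exact hs.le
  filter_upwards [eventually_all.2 hact, eventually_all.2 hfirst, eventually_all.2 hder,
    hlim.eventually (hU.mem_nhds hxU)] with s hs1 hs2 hs3 hsU M hM
  have hconv : Convex ℝ {M : E →L[ℝ] F | ‖f (x + s) - f x - M s‖ ≤ ε * ‖s‖} := by
    intro M₁ hM₁ M₂ hM₂ a b ha hb hab
    simp only [mem_ofPred_eq] at hM₁ hM₂ ⊢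
    have h : f (x + s) - f x - (a • M₁ + b • M₂) s =
        a • (f (x + s) - f x - M₁ s) + b • (f (x + s) - f x - M₂ s) := by
      have h1 : f (x + s) - f x = a • (f (x + s) - f x) + b • (f (x + s) - f x) := by
        rw [← add_smul, hab, one_smul]
      nth_rewrite 1 [h1]
      simp only [add_apply, smul_apply, smul_sub]
      abel
    rw [h]
    refine (norm_add_le _ _).trans ?_
    rw [norm_smul, norm_smul, Real.norm_of_nonneg ha, Real.norm_of_nonneg hb]
    calc _ ≤ a * (ε * ‖s‖) + b * (ε * ‖s‖) := by gcongr
      _ = ε * ‖s‖ := by rw [← add_mul, hab, one_mul]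
  refine convexHull_min ?_ hconv hM
  rintro M ⟨y, hyd, hy, hyM⟩
  have hyU : ∀ᶠ k in atTop, y k ∈ U := hy.eventually (hU.mem_nhds hsU)
  obtain ⟨i, hi⟩ := exists_frequently_of_eventually_exists
    (p := fun i k => f (y k) = φ i (y k) ∧ fderiv ℝ f (y k) = fderiv ℝ (φ i) (y k))
    (hyU.mono fun k hk => fderiv_eq_of_selection hU hφ hsel hk (hyd k))
  have h1 : f (x + s) = φ i (x + s) := tendsto_nhds_unique_of_frequently_eq
    ((hf.1.tendsto _).comp hy) (((hc i).continuousAt (hU.mem_nhds hsU)).tendsto.comp hy)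
    (hi.mono fun k hk => hk.1)
  have h2 : M = fderiv ℝ (φ i) (x + s) := tendsto_nhds_unique_of_frequently_eq hyM
    (((hdc i).continuousAt (hU.mem_nhds hsU)).tendsto.comp hy) (hi.mono fun k hk => hk.2)
  have h3 : φ i (x + s) - φ i x - fderiv ℝ (φ i) (x + s) s =
      (φ i (x + s) - φ i x - fderiv ℝ (φ i) x s)
        - (fderiv ℝ (φ i) (x + s) - fderiv ℝ (φ i) x) s := by
    simp only [sub_apply]; abel
  simp only [mem_ofPred_eq]
  rw [h2, h1, hs1 i h1, h3]
  calc _ ≤ ε / 2 * ‖s‖ + ε / 2 * ‖s‖ := (norm_sub_le _ _).trans (add_le_add (hs2 i)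
        ((ContinuousLinearMap.le_opNorm _ _).trans
          (mul_le_mul_of_nonneg_right (hs3 i) (norm_nonneg s))))
    _ = ε * ‖s‖ := by ring

/-- Piecewise `C¹` functions are semismooth. -/
theorem IsPC1.isSemismooth {f : E → F} (hf : IsPC1 f) : IsSemismooth f := fun x =>
  ⟨hf.lipschitz_near x, hf.exists_directional_deriv x, fun _ hε => hf.clarkeJacobian_approx x hε⟩

theorem IsPC1.comp_graph {f : E → F} (hf : IsPC1 f) {Ψ : E × F → G} (hΨ : ContDiff ℝ 1 Ψ) :
    IsPC1 fun x => Ψ (x, f x) := by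
  refine ⟨hΨ.continuous.comp (continuous_id.prodMk hf.1), fun x => ?_⟩
  obtain ⟨U, hU, hxU, N, φ, hφ, hsel⟩ := hf.2 x
  refine ⟨U, hU, hxU, N, fun i x => Ψ (x, φ i x), fun i =>
    hΨ.comp_contDiffOn (contDiffOn_id.prodMk (hφ i)), fun y hy => ?_⟩
  obtain ⟨i, hi⟩ := hsel y hy
  exact ⟨i, by simp only [hi]⟩

/-- If `f` has the derivative `M` at points `y k → x`, then the chain rule with `M` as derivative
of `f` at `x` yields an element of the generalized Jacobian of `x ↦ Ψ (x, f x)`. -/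
theorem comp_graph_mem_clarkeJacobian {f : E → F} (hf : Continuous f) {Ψ : E × F → G}
    (hΨ : ContDiff ℝ 1 Ψ) {x : E} {M : E →L[ℝ] F} {y : ℕ → E} (hy : Tendsto y atTop (𝓝 x))
    (hM : ∀ k, HasFDerivAt f M (y k)) {Ψ' : E × F →L[ℝ] G} (hΨ' : HasFDerivAt Ψ Ψ' (x, f x)) :
    Ψ'.comp ((ContinuousLinearMap.id ℝ E).prod M) ∈ clarkeJacobian (fun x => Ψ (x, f x)) x := by
  have hd : ∀ k, HasFDerivAt (fun x => Ψ (x, f x))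
      ((fderiv ℝ Ψ (y k, f (y k))).comp ((ContinuousLinearMap.id ℝ E).prod M)) (y k) := fun k =>
    ((hΨ.differentiable one_ne_zero) (y k, f (y k))).hasFDerivAt.comp (y k)
      ((hasFDerivAt_id (y k)).prodMk (hM k))
  refine subset_convexHull ℝ _ ⟨y, fun k => (hd k).differentiableAt, hy, ?_⟩
  simp_rw [fun k => (hd k).fderiv]
  rw [← hΨ'.fderiv]
  have hc : Continuous fun z => fderiv ℝ Ψ (z, f z) :=
    (hΨ.continuous_fderiv one_ne_zero).comp (continuous_id.prodMk hf)
  exact ((hc.clm_comp continuous_const).tendsto x).comp hy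

end PiecewiseC1

/-! ### Finitely generated cones and convex polygons as intersections of half-spaces. -/

section Polyhedral

variable {V : Type*} [AddCommGroup V] [Module ℝ V]

/-- Fourier-Motzkin elimination: adding a generator to a polyhedral cone. -/
theorem exists_finite_halfspaces_add_ray {Φ : Set (V →ₗ[ℝ] ℝ)} (hΦ : Φ.Finite) (v : V) :
    ∃ Φ' : Set (V →ₗ[ℝ] ℝ), Φ'.Finite ∧
      ∀ x, (∃ r : ℝ, 0 ≤ r ∧ ∀ φ ∈ Φ, φ (x - r • v) ≤ 0) ↔ ∀ φ ∈ Φ', φ x ≤ 0 := by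
  -- A form with `φ v > 0` bounds `r` from below by `φ x / φ v`, one with `ψ v < 0` bounds it from
  -- above. A suitable `r ≥ 0` exists iff each lower bound, including 0, is at most each upper
  -- bound; the combined forms express this without `r`.
  refine ⟨{φ ∈ Φ | φ v ≤ 0} ∪
      image2 (fun φ ψ => φ v • ψ - ψ v • φ) {φ ∈ Φ | 0 < φ v} {ψ ∈ Φ | ψ v < 0},
    (hΦ.subset (sep_subset _ _)).union
      ((hΦ.subset (sep_subset _ _)).image2 _ (hΦ.subset (sep_subset _ _))),
    fun x => ⟨?_, fun h => ?_⟩⟩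
  · rintro ⟨r, hr, hx⟩ χ (⟨hχ, hχv⟩ | ⟨φ, ⟨hφ, hφv⟩, ψ, ⟨hψ, hψv⟩, rfl⟩)
    · have := hx χ hχ
      simp only [map_sub, map_smul, smul_eq_mul] at this
      nlinarith
    · have h1 := hx φ hφ
      have h2 := hx ψ hψ
      simp only [map_sub, map_smul, smul_eq_mul, LinearMap.sub_apply, LinearMap.smul_apply]
        at h1 h2 ⊢
      nlinarith
  · have hle : ∀ φ ∈ Φ, φ v ≤ 0 → φ x ≤ 0 := fun φ hφ hφv => h φ (Or.inl ⟨hφ, hφv⟩)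
    have hmix : ∀ φ ∈ Φ, ∀ ψ ∈ Φ, 0 < φ v → ψ v < 0 → φ v * ψ x ≤ ψ v * φ x := by
      intro φ hφ ψ hψ hφv hψv
      simpa using h (φ v • ψ - ψ v • φ) (Or.inr ⟨φ, ⟨hφ, hφv⟩, ψ, ⟨hψ, hψv⟩, rfl⟩)
    have hfin : (insert 0 ((fun φ => φ x / φ v) '' {φ ∈ Φ | 0 < φ v})).Finite :=
      ((hΦ.subset (sep_subset _ _)).image _).insert _
    -- The witness is the largest lower bound.
    obtain ⟨r, hr, hmax⟩ := exists_max_image _ id hfin (insert_nonempty _ _)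
    refine ⟨r, hmax 0 (mem_insert _ _), fun φ hφ => ?_⟩
    simp only [map_sub, map_smul, smul_eq_mul]
    rcases lt_trichotomy (φ v) 0 with hv | hv | hv
    · rcases hr with rfl | ⟨ψ, ⟨hψ, hψv⟩, rfl⟩
      · simpa using hle φ hφ hv.le
      · have := hmix ψ hψ φ hφ hψv hv
        have h2 : ψ x / ψ v * φ v = φ v * ψ x / ψ v := by ring
        rw [sub_nonpos]
        dsimp only
        rw [h2, le_div_iff₀ hψv]
        linarith
    · have := hle φ hφ hv.le
      rw [hv]; linarith
    · have := hmax (φ x / φ v) (mem_insert_of_mem _ ⟨φ, ⟨hφ, hv⟩, rfl⟩)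
      simp only [id] at this
      rw [div_le_iff₀ hv] at this
      linarith

theorem exists_finite_halfspaces_cone [FiniteDimensional ℝ V] (S : Finset V) :
    ∃ Φ : Set (V →ₗ[ℝ] ℝ), Φ.Finite ∧
      ∀ x, (∃ w : V → ℝ, (∀ s ∈ S, 0 ≤ w s) ∧ ∑ s ∈ S, w s • s = x) ↔ ∀ φ ∈ Φ, φ x ≤ 0 := by
  classical
  induction S using Finset.induction_on with
  | empty =>
    let b := Module.finBasis ℝ V
    -- Without generators the cone is `{0}`, cut out by the coordinates and their negatives.
    refine ⟨range b.coord ∪ range fun i => -b.coord i, (finite_range _).union (finite_range _),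
      fun x => ⟨?_, fun h => ?_⟩⟩
    · rintro ⟨w, -, rfl⟩ φ -
      simp
    · refine ⟨0, by simp, ?_⟩
      refine (b.ext_elem fun i => ?_).symm
      have h1 := h _ (Or.inl ⟨i, rfl⟩)
      have h2 := h _ (Or.inr ⟨i, rfl⟩)
      simp only [Module.Basis.coord_apply, LinearMap.neg_apply] at h1 h2
      simp only [Finset.sum_empty, map_zero, Finsupp.coe_zero, Pi.zero_apply]
      linarith
  | insert v S hv ih =>
    obtain ⟨Φ, hΦ, h⟩ := ih
    obtain ⟨Φ', hΦ', h'⟩ := exists_finite_halfspaces_add_ray hΦ v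
    refine ⟨Φ', hΦ', fun x => ?_⟩
    rw [← h']
    simp_rw [← h]
    constructor
    · rintro ⟨w, hw, rfl⟩
      refine ⟨w v, hw v (Finset.mem_insert_self _ _), w,
        fun s hs => hw s (Finset.mem_insert_of_mem hs), ?_⟩
      rw [Finset.sum_insert hv]
      abel
    · rintro ⟨r, hr, w, hw, hx⟩
      have hne : ∀ s ∈ S, s ≠ v := fun s hs hsv => hv (hsv ▸ hs)
      refine ⟨fun s => if s = v then r else w s, fun s hs => ?_, ?_⟩
      · rcases Finset.mem_insert.1 hs with rfl | hs
        · simpa using hr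
        · simpa [hne s hs] using hw s hs
      · have hsum : ∑ s ∈ S, (if s = v then r else w s) • s = ∑ s ∈ S, w s • s :=
          Finset.sum_congr rfl fun s hs => by rw [if_neg (hne s hs)]
        rw [Finset.sum_insert hv, hsum, hx]
        simp

end Polyhedral

/-- A convex polygon is a finite intersection of closed half-planes. -/
theorem IsConvexPolygon.exists_halfplanes {D : Set Plane} (hD : IsConvexPolygon D) :
    ∃ (κ : Type) (_ : Fintype κ) (b : κ → Plane) (c : κ → ℝ),
      (∀ m, b m ≠ 0) ∧ D = {x | ∀ m, inner ℝ (b m) x ≤ c m} := by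
  classical
  obtain ⟨⟨S, hS⟩, h_int⟩ := hD
  -- Homogenization: the polygon is the slice at height 1 of the cone generated by the lifted
  -- vertices.
  obtain ⟨Φ, hΦ, h⟩ := exists_finite_halfspaces_cone (S.image fun s : Plane => (s, (1 : ℝ)))
  have hmem : ∀ x, x ∈ D ↔ ∀ φ ∈ Φ, φ (x, 1) ≤ 0 := by
    intro x
    rw [← h, hS, Finset.mem_convexHull']
    have hinj : ∀ w : Plane × ℝ → ℝ, ∑ s ∈ S.image (fun s : Plane => (s, (1 : ℝ))), w s • s =
        (∑ s ∈ S, w (s, 1) • s, ∑ s ∈ S, w (s, 1)) := fun w => by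
      rw [Finset.sum_image fun s _ t _ hst => congrArg Prod.fst hst, Prod.ext_iff]
      simp [Prod.fst_sum, Prod.snd_sum]
    constructor
    · rintro ⟨w, hw, h1, h2⟩
      refine ⟨fun p => w p.1, fun s hs => ?_, by rw [hinj]; simp [h1, h2]⟩
      obtain ⟨s, hs', rfl⟩ := Finset.mem_image.1 hs
      exact hw s hs'
    · rintro ⟨w, hw, h1⟩
      rw [hinj, Prod.ext_iff] at h1
      exact ⟨fun s => w (s, 1), fun s hs => hw _ (Finset.mem_image_of_mem _ hs), h1.2, h1.1⟩
  have hrep : ∀ φ : Plane × ℝ →ₗ[ℝ] ℝ, ∃ b : Plane, ∀ x, φ (x, 1) = inner ℝ b x + φ (0, 1) := by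
    intro φ
    refine ⟨(InnerProductSpace.toDual ℝ Plane).symm
      (LinearMap.toContinuousLinearMap (φ.comp (LinearMap.inl ℝ Plane ℝ))), fun x => ?_⟩
    rw [InnerProductSpace.toDual_symm_apply]
    simp [← map_add]
  choose b hb using hrep
  have := hΦ.to_subtype
  obtain ⟨x₀, hx₀⟩ := h_int
  have hx₀ := interior_subset hx₀
  -- Forms with zero normal are constant at height 1. They hold at a point of `D`, hence everywhere,
  -- and can be dropped.
  refine ⟨{φ : Φ // b φ ≠ 0}, Fintype.ofFinite _, fun φ => b φ,
    fun φ => -(φ : Plane × ℝ →ₗ[ℝ] ℝ) (0, 1), fun φ => φ.2, Set.ext fun x => ?_⟩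
  rw [hmem, mem_ofPred_eq]
  constructor
  · rintro hx ⟨⟨φ, hφ⟩, -⟩
    have := hx φ hφ
    rw [hb] at this
    linarith
  · intro hx φ hφ
    by_cases h0 : b φ = 0
    · have := (hmem x₀).1 hx₀ φ hφ
      rw [hb, h0, inner_zero_left] at this ⊢
      exact this
    · have := hx ⟨⟨φ, hφ⟩, h0⟩
      rw [hb]
      linarith

/-! ### Selections of finitely many C¹ functions. -/

section Selection

variable {E F : Type*} [NormedAddCommGroup E] [NormedSpace ℝ E]
  [NormedAddCommGroup F] [NormedSpace ℝ F]

/-- `f` is a selection of finitely many globally defined `C¹` functions. -/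
def IsC1Selection (f : E → F) : Prop :=
  ∃ S : Set (E → F), S.Finite ∧ (∀ φ ∈ S, ContDiff ℝ 1 φ) ∧ ∀ x, ∃ φ ∈ S, f x = φ x

theorem IsC1Selection.isPC1 {f : E → F} (hf : IsC1Selection f) (hc : Continuous f) : IsPC1 f := by
  obtain ⟨S, hS, hC, hsel⟩ := hf
  obtain ⟨N, φ, -, rfl⟩ := hS.fin_param
  refine ⟨hc, fun x => ⟨univ, isOpen_univ, mem_univ x, N, φ,
    fun i => (hC _ (mem_range_self i)).contDiffOn, fun y _ => ?_⟩⟩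
  obtain ⟨_, ⟨i, rfl⟩, h⟩ := hsel y
  exact ⟨i, h⟩

theorem IsC1Selection.sub {f g : E → F} (hf : IsC1Selection f) (hg : IsC1Selection g) :
    IsC1Selection fun x => f x - g x := by
  obtain ⟨S, hS, hSC, hSs⟩ := hf
  obtain ⟨T, hT, hTC, hTs⟩ := hg
  refine ⟨image2 (fun φ χ x => φ x - χ x) S T, hS.image2 _ hT, ?_, fun x => ?_⟩
  · rintro _ ⟨φ, hφ, χ, hχ, rfl⟩
    exact (hSC φ hφ).sub (hTC χ hχ)
  · obtain ⟨φ, hφ, h1⟩ := hSs x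
    obtain ⟨χ, hχ, h2⟩ := hTs x
    exact ⟨_, mem_image2_of_mem hφ hχ, by simp only [h1, h2]⟩

theorem IsC1Selection.finsetSum {ι : Type*} [Fintype ι] {f : ι → E → F}
    (hf : ∀ i, IsC1Selection (f i)) : IsC1Selection fun x => ∑ i, f i x := by
  choose S hS hSC hSs using hf
  refine ⟨(fun φ x => ∑ i, φ i x) '' pi univ S, (Finite.pi hS).image _, ?_, fun x => ?_⟩
  · rintro _ ⟨φ, hφ, rfl⟩
    exact ContDiff.sum fun i _ => hSC i _ (hφ i (mem_univ i))
  · choose φ hφ h using fun i => hSs i x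
    exact ⟨_, ⟨φ, fun i _ => hφ i, rfl⟩, by simp only [h]⟩

theorem IsC1Selection.toLp {n : ℕ} {f : Fin n → E → ℝ} (hf : ∀ i, IsC1Selection (f i)) :
    IsC1Selection fun x => (WithLp.toLp 2 fun i => f i x : Vec n) := by
  choose S hS hSC hSs using hf
  refine ⟨(fun φ x => WithLp.toLp 2 fun i => φ i x) '' pi univ S, (Finite.pi hS).image _, ?_,
    fun x => ?_⟩
  · rintro _ ⟨φ, hφ, rfl⟩
    exact contDiff_euclidean.2 fun i => hSC i _ (hφ i (mem_univ i))
  · choose φ hφ h using fun i => hSs i x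
    exact ⟨_, ⟨φ, fun i _ => hφ i, rfl⟩, by simp only [h]⟩

/-- The integral over an interval cut out by finitely many linear inequalities. -/
theorem isC1Selection_setIntegral {K : Type*} [Finite K] {κ : K → ℝ} {f : K → E → ℝ}
    {w : K → Prop} (hf : ∀ k, ContDiff ℝ 1 (f k)) (hpos : ∃ k, 0 < κ k) (hneg : ∃ k, κ k < 0)
    {q : ℝ → ℝ → ℝ} {Q : ℝ × ℝ → ℝ} (hQ : ContDiff ℝ 1 Q)
    (hqQ : ∀ α β e, ∫ s in α..β, q s e = Q (β, e) - Q (α, e)) {e : E → ℝ}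
    (he : ContDiff ℝ 1 e) :
    IsC1Selection fun ξ =>
      ∫ s in {s | ∀ k, κ k * s < f k ξ ∨ (w k ∧ κ k * s = f k ξ)}, q s (e ξ) := by
  -- Either the interval is null, or its right end is `f k ξ / κ k` for some `κ k > 0` and its left
  -- end `f l ξ / κ l` for some `κ l < 0`. Whether an endpoint belongs to the set does not affect
  -- the integral.
  refine ⟨insert 0 (range fun p : K × K => fun ξ =>
      Q (f p.1 ξ / κ p.1, e ξ) - Q (f p.2 ξ / κ p.2, e ξ)), (finite_range _).insert _, ?_,
      fun ξ => ?_⟩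
  · rintro _ (rfl | ⟨p, rfl⟩)
    · exact contDiff_const
    · exact (hQ.comp (((hf _).div_const _).prodMk he)).sub
        (hQ.comp (((hf _).div_const _).prodMk he))
  set I := {s | ∀ k, κ k * s < f k ξ ∨ (w k ∧ κ k * s = f k ξ)} with hI
  have hIle : ∀ s ∈ I, ∀ k, κ k * s ≤ f k ξ := fun s hs k => by
    rcases hs k with h | h
    exacts [h.le, h.2.le]
  -- A constraint with `κ k = 0` does not involve `s`: it is either void or empties the set.
  by_cases hzero : ∀ k, κ k = 0 → 0 < f k ξ ∨ (w k ∧ 0 = f k ξ)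
  swap
  · push Not at hzero
    obtain ⟨k, hk, h1, h2⟩ := hzero
    refine ⟨0, mem_insert _ _, ?_⟩
    have : I = ∅ := eq_empty_of_forall_notMem fun s hs => by
      have := hs k
      rw [hk, zero_mul] at this
      rcases this with h | h
      exacts [h1.not_gt h, h2 h.1 h.2]
    change ∫ s in I, q s (e ξ) = 0
    simp [this]
  obtain ⟨k, hk, hkmin⟩ := exists_min_image {k | 0 < κ k} (fun k => f k ξ / κ k) (toFinite _) hpos
  obtain ⟨l, hl, hlmax⟩ := exists_max_image {k | κ k < 0} (fun k => f k ξ / κ k) (toFinite _) hneg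
  simp only [mem_ofPred_eq] at hk hl hkmin hlmax
  have hsub : I ⊆ Icc (f l ξ / κ l) (f k ξ / κ k) := fun s hs =>
    ⟨by rw [div_le_iff_of_neg hl, mul_comm]; exact hIle s hs l,
      by rw [le_div_iff₀ hk, mul_comm]; exact hIle s hs k⟩
  rcases lt_or_ge (f l ξ / κ l) (f k ξ / κ k) with hlt | hge
  · refine ⟨_, mem_insert_of_mem _ ⟨(k, l), rfl⟩, ?_⟩
    dsimp only
    rw [← hqQ, intervalIntegral.integral_of_le hlt.le]
    have hsup : Ioo (f l ξ / κ l) (f k ξ / κ k) ⊆ I := fun s hs m => by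
      rcases lt_trichotomy (κ m) 0 with hm | hm | hm
      · left
        have := (hlmax m hm).trans_lt hs.1
        rwa [div_lt_iff_of_neg hm, mul_comm] at this
      · rw [hm, zero_mul]
        exact hzero m hm
      · left
        have := hs.2.trans_le (hkmin m hm)
        rwa [lt_div_iff₀ hm, mul_comm] at this
    refine setIntegral_congr_set ?_
    refine EventuallyLE.antisymm ?_ ?_
    · exact hsub.eventuallyLE.trans Ioc_ae_eq_Icc.symm.le
    · exact Ioo_ae_eq_Ioc.symm.le.trans hsup.eventuallyLE
  · refine ⟨0, mem_insert _ _, setIntegral_measure_zero _ (measure_mono_null hsub ?_)⟩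
    rw [Real.volume_Icc, ENNReal.ofReal_eq_zero]
    linarith

end Selection

/-! ### Primitives of the density along slices. -/

section Primitive

variable {ψ : ℝ → ℝ → ℝ}

/-- The primitive of `ψ s` that vanishes at `0`. -/
noncomputable def sliceprim (ψ : ℝ → ℝ → ℝ) (s r : ℝ) : ℝ := ∫ x in (0 : ℝ)..r, ψ s x

theorem continuous_sliceprim (hψ : Continuous ↿ψ) : Continuous ↿(sliceprim ψ) :=
  intervalIntegral.continuous_parametric_intervalIntegral_of_continuous
    (f := fun p : ℝ × ℝ => ψ p.1) (s := fun p => p.2)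
    (hψ.comp ((continuous_fst.comp continuous_fst).prodMk continuous_snd)) continuous_snd

theorem hasDerivAt_sliceprim (hψ : Continuous ↿ψ) (s r : ℝ) :
    HasDerivAt (sliceprim ψ s) (ψ s r) r :=
  (Continuous.integral_hasStrictDerivAt (hψ.comp (by fun_prop : Continuous fun x => (s, x)))
    0 r).hasDerivAt

/-- Both partial derivatives exist and are continuous: in the endpoint by the fundamental theorem of
calculus, in the offset by differentiation under the integral sign. Merely continuous `ψ` suffices,
since the offset enters only through the primitive. -/
theorem contDiff_integral_sliceprim (hψ : Continuous ↿ψ) {C : ℝ} (hC : ∀ s r, ‖ψ s r‖ ≤ C)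
    (d : ℝ) :
    ContDiff ℝ 1 fun p : ℝ × ℝ => ∫ s in (0 : ℝ)..p.1, sliceprim ψ s (p.2 - d * s) := by
  have hR := continuous_sliceprim hψ
  have hRc : Continuous fun p : ℝ × ℝ => sliceprim ψ p.1 (p.2 - d * p.1) :=
    hR.comp (by fun_prop : Continuous fun p : ℝ × ℝ => (p.1, p.2 - d * p.1))
  have hψc : Continuous fun p : ℝ × ℝ => ψ p.1 (p.2 - d * p.1) :=
    hψ.comp (by fun_prop : Continuous fun p : ℝ × ℝ => (p.1, p.2 - d * p.1))
  have hRe : ∀ e, Continuous fun s => sliceprim ψ s (e - d * s) := fun e =>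
    hRc.comp (by fun_prop : Continuous fun s : ℝ => (s, e))
  have hψe : ∀ e, Continuous fun s => ψ s (e - d * s) := fun e =>
    hψc.comp (by fun_prop : Continuous fun s : ℝ => (s, e))
  let f₁ : ℝ → ℝ → ℝ →L[ℝ] ℝ := fun β e =>
    ContinuousLinearMap.toSpanSingleton ℝ (sliceprim ψ β (e - d * β))
  let f₂ : ℝ → ℝ → ℝ →L[ℝ] ℝ := fun β e =>
    ContinuousLinearMap.toSpanSingleton ℝ (∫ s in (0 : ℝ)..β, ψ s (e - d * s))
  have hspan : Continuous fun x : ℝ => ContinuousLinearMap.toSpanSingleton ℝ x :=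
    (ContinuousLinearMap.toSpanSingletonCLE (𝕜 := ℝ) (E := ℝ)).continuous
  have hf₁ : Continuous ↿f₁ := hspan.comp hRc
  have hf₂ : Continuous ↿f₂ := hspan.comp
    (intervalIntegral.continuous_parametric_intervalIntegral_of_continuous
      (f := fun (p : ℝ × ℝ) s => ψ s (p.2 - d * s)) (s := fun p => p.1)
      (hψ.comp (by fun_prop : Continuous fun p : (ℝ × ℝ) × ℝ => (p.2, p.1.2 - d * p.2)))
      continuous_fst)
  rw [contDiff_one_iff_hasFDerivAt]
  refine ⟨fun p => (f₁ p.1 p.2).coprod (f₂ p.1 p.2), ?_, fun p => ?_⟩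
  · have h : (fun p : ℝ × ℝ => (f₁ p.1 p.2).coprod (f₂ p.1 p.2)) = fun p =>
        (f₁ p.1 p.2).comp (ContinuousLinearMap.fst ℝ ℝ ℝ) +
          (f₂ p.1 p.2).comp (ContinuousLinearMap.snd ℝ ℝ ℝ) := by
      funext p; ext <;> simp
    rw [h]
    exact (hf₁.clm_comp continuous_const).add (hf₂.clm_comp continuous_const)
  refine (hasStrictFDerivAt_uncurry_coprod (u := p)
    (f := fun β e => ∫ s in (0 : ℝ)..β, sliceprim ψ s (e - d * s)) (f₁ := f₁) (f₂ := f₂)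
    (Eventually.of_forall fun v => ?_) (Eventually.of_forall fun v => ?_)
    hf₁.continuousAt hf₂.continuousAt).hasFDerivAt
  · exact (Continuous.integral_hasStrictDerivAt (hRe v.2) 0 v.1).hasDerivAt.hasFDerivAt
  · refine HasDerivAt.hasFDerivAt ?_
    refine (intervalIntegral.hasDerivAt_integral_of_dominated_loc_of_deriv_le (s := univ)
      (F := fun e s => sliceprim ψ s (e - d * s)) (F' := fun e s => ψ s (e - d * s))
      (bound := fun _ => C) univ_mem
      (Eventually.of_forall fun e => (hRe e).aestronglyMeasurable)
      ((hRe _).intervalIntegrable _ _) (hψe _).aestronglyMeasurable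
      (Eventually.of_forall fun s _ e _ => hC _ _) (by simp)
      (Eventually.of_forall fun s _ e _ => ?_)).2
    exact (hasDerivAt_sliceprim hψ s (e - d * s)).comp_sub_const e (d * s)

end Primitive

/-! ### Integrals over regions between graphs of affine functions. -/

section Slices

/-- Breaking ties by the order of the indices makes the minimizer unique, so a sum over all
candidate minimizers counts it exactly once. -/
theorem exists_first_min {ι : Type*} [Finite ι] [LinearOrder ι] [Nonempty ι] (u : ι → ℝ) :
    ∃ p, ∀ p', (∀ j, u p' < u j ∨ p' ≤ j ∧ u p' = u j) ↔ p' = p := by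
  obtain ⟨p, hp⟩ := Finite.exists_min fun p => toLex (u p, p)
  simp only [Prod.Lex.toLex_le_toLex] at hp
  refine ⟨p, fun p' => ⟨fun h => ?_, ?_⟩⟩
  · rcases h p with h1 | h1 <;> rcases hp p' with h2 | h2
    · exact absurd h1 h2.not_gt
    · exact absurd h1 h2.1.symm.not_lt
    · exact absurd h2 h1.2.not_gt
    · exact le_antisymm h1.1 h2.2
  · rintro rfl j
    exact (hp j).imp id fun h => ⟨h.2, h.1⟩

-- The slice is the interval from the largest `v q` to the smallest `u p`. Exactly one index in each
-- sum passes the first-minimizer test, and the remaining condition makes both sums vanish when the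
-- interval is empty.
open Classical in
theorem setIntegral_between {ι₁ ι₂ : Type*} [Fintype ι₁] [LinearOrder ι₁] [Nonempty ι₁]
    [Fintype ι₂] [LinearOrder ι₂] [Nonempty ι₂] (u : ι₁ → ℝ) (v : ι₂ → ℝ) {h : ℝ → ℝ}
    (hh : Continuous h) :
    ∫ r in {r | (∀ p, r ≤ u p) ∧ ∀ q, v q ≤ r}, h r =
      (∑ p, if (∀ j, u p < u j ∨ p ≤ j ∧ u p = u j) ∧ ∀ q, v q ≤ u p then
        ∫ x in (0 : ℝ)..u p, h x else 0) -
      ∑ q, if (∀ j, -v q < -v j ∨ q ≤ j ∧ -v q = -v j) ∧ ∀ p, v q ≤ u p then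
        ∫ x in (0 : ℝ)..v q, h x else 0 := by
  obtain ⟨p, hp⟩ := exists_first_min u
  obtain ⟨q, hq⟩ := exists_first_min fun q => -v q
  have hpmin : ∀ j, u p ≤ u j := fun j => by
    rcases (hp p).2 rfl j with h | h
    exacts [h.le, h.2.le]
  have hqmax : ∀ j, v j ≤ v q := fun j => by
    rcases (hq q).2 rfl j with h | h <;> linarith [h]
  have hp' : ∀ j, (∀ q', v q' ≤ u j) ↔ v q ≤ u j := fun j =>
    ⟨fun h => h q, fun h q' => (hqmax q').trans h⟩
  have hq' : ∀ j, (∀ p', v j ≤ u p') ↔ v j ≤ u p := fun j =>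
    ⟨fun h => h p, fun h p' => h.trans (hpmin p')⟩
  have hset : {r | (∀ p, r ≤ u p) ∧ ∀ q, v q ≤ r} = Icc (v q) (u p) := Set.ext fun r =>
    ⟨fun h => ⟨h.2 q, h.1 p⟩, fun h =>
      ⟨fun p' => h.2.trans (hpmin p'), fun q' => (hqmax q').trans h.1⟩⟩
  simp_rw [hp, hq, hp', hq', ite_and, Finset.sum_ite_eq', Finset.mem_univ, if_true]
  rw [hset]
  by_cases hle : v q ≤ u p
  · rw [if_pos hle, if_pos hle, integral_Icc_eq_integral_Ioc, ← intervalIntegral.integral_of_le hle,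
      intervalIntegral.integral_interval_sub_left (hh.intervalIntegrable _ _)
        (hh.intervalIntegrable _ _)]
  · rw [if_neg hle, if_neg hle, Icc_eq_empty hle]
    simp

open Classical in
/-- The integral over a region between graphs of affine functions depends piecewise `C¹` on the
coefficients. -/
theorem isC1Selection_between {E ι₁ ι₂ ι₃ : Type*} [NormedAddCommGroup E] [NormedSpace ℝ E]
    [Fintype ι₁] [LinearOrder ι₁] [Nonempty ι₁] [Fintype ι₂] [LinearOrder ι₂] [Nonempty ι₂]
    [Fintype ι₃] {ψ : ℝ → ℝ → ℝ} (hψ : Continuous ↿ψ) {C : ℝ} (hC : ∀ s r, ‖ψ s r‖ ≤ C)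
    {d₁ : ι₁ → ℝ} {e₁ : ι₁ → E → ℝ} (he₁ : ∀ p, ContDiff ℝ 1 (e₁ p))
    {d₂ : ι₂ → ℝ} {e₂ : ι₂ → E → ℝ} (he₂ : ∀ p, ContDiff ℝ 1 (e₂ p))
    {κ : ι₃ → ℝ} {f : ι₃ → E → ℝ} (hf : ∀ k, ContDiff ℝ 1 (f k))
    (hpos : ∃ k, 0 < κ k) (hneg : ∃ k, κ k < 0) :
    IsC1Selection fun ξ => ∫ s in {s | ∀ k, κ k * s ≤ f k ξ},
      ∫ r in {r | (∀ p, r ≤ e₁ p ξ - d₁ p * s) ∧ ∀ q, e₂ q ξ - d₂ q * s ≤ r}, ψ s r := by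
  have hR := continuous_sliceprim hψ
  have hRc : ∀ d e, Continuous fun s => sliceprim ψ s (e - d * s) := fun d e =>
    hR.comp (by fun_prop : Continuous fun s => (s, e - d * s))
  have hQ : ∀ d α β e, ∫ s in α..β, sliceprim ψ s (e - d * s) =
      (∫ s in (0 : ℝ)..β, sliceprim ψ s (e - d * s)) -
        ∫ s in (0 : ℝ)..α, sliceprim ψ s (e - d * s) := fun d α β e =>
    (intervalIntegral.integral_interval_sub_left ((hRc d e).intervalIntegrable _ _)
      ((hRc d e).intervalIntegrable _ _)).symm
  obtain ⟨kp, hkp⟩ := hpos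
  obtain ⟨kn, hkn⟩ := hneg
  -- For fixed `p`, the `s` in the outer range at which `p` is the first minimal upper graph and
  -- lies above all lower graphs are described by inequalities linear in `s`. The flag `p ≤ j`
  -- encodes the tie-break; the other inequalities are weak.
  have hsel₁ : ∀ p, IsC1Selection fun ξ => ∫ s in {s | ∀ k : ι₃ ⊕ ι₁ ⊕ ι₂,
      Sum.elim κ (Sum.elim (fun j => d₁ j - d₁ p) fun q => d₁ p - d₂ q) k * s <
        (Sum.elim f (Sum.elim (fun j ξ => e₁ j ξ - e₁ p ξ) fun q ξ => e₁ p ξ - e₂ q ξ) k ξ : ℝ) ∨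
      (Sum.elim (fun _ => True) (Sum.elim (fun j => p ≤ j) fun _ => True) k ∧
        Sum.elim κ (Sum.elim (fun j => d₁ j - d₁ p) fun q => d₁ p - d₂ q) k * s =
          Sum.elim f (Sum.elim (fun j ξ => e₁ j ξ - e₁ p ξ) fun q ξ => e₁ p ξ - e₂ q ξ) k ξ)},
      sliceprim ψ s (e₁ p ξ - d₁ p * s) := fun p =>
    isC1Selection_setIntegral (q := fun s e => sliceprim ψ s (e - d₁ p * s))
      (by
        rintro (k | j | q)
        exacts [hf k, (he₁ j).sub (he₁ p), (he₁ p).sub (he₂ q)])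
      ⟨Sum.inl kp, hkp⟩ ⟨Sum.inl kn, hkn⟩ (contDiff_integral_sliceprim hψ hC (d₁ p))
      (hQ (d₁ p)) (he₁ p)
  have hsel₂ : ∀ q, IsC1Selection fun ξ => ∫ s in {s | ∀ k : ι₃ ⊕ ι₂ ⊕ ι₁,
      Sum.elim κ (Sum.elim (fun j => d₂ q - d₂ j) fun p => d₁ p - d₂ q) k * s <
        (Sum.elim f (Sum.elim (fun j ξ => e₂ q ξ - e₂ j ξ) fun p ξ => e₁ p ξ - e₂ q ξ) k ξ : ℝ) ∨
      (Sum.elim (fun _ => True) (Sum.elim (fun j => q ≤ j) fun _ => True) k ∧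
        Sum.elim κ (Sum.elim (fun j => d₂ q - d₂ j) fun p => d₁ p - d₂ q) k * s =
          Sum.elim f (Sum.elim (fun j ξ => e₂ q ξ - e₂ j ξ) fun p ξ => e₁ p ξ - e₂ q ξ) k ξ)},
      sliceprim ψ s (e₂ q ξ - d₂ q * s) := fun q =>
    isC1Selection_setIntegral (q := fun s e => sliceprim ψ s (e - d₂ q * s))
      (by
        rintro (k | j | p)
        exacts [hf k, (he₂ q).sub (he₂ j), (he₁ p).sub (he₂ q)])
      ⟨Sum.inl kp, hkp⟩ ⟨Sum.inl kn, hkn⟩ (contDiff_integral_sliceprim hψ hC (d₂ q))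
      (hQ (d₂ q)) (he₂ q)
  convert (IsC1Selection.finsetSum hsel₁).sub (IsC1Selection.finsetSum hsel₂) using 2 with ξ
  set S := {s | ∀ k, κ k * s ≤ f k ξ} with hS
  have hSsub : S ⊆ Icc (f kn ξ / κ kn) (f kp ξ / κ kp) := fun s hs =>
    ⟨by rw [div_le_iff_of_neg hkn, mul_comm]; exact hs kn,
      by rw [le_div_iff₀ hkp, mul_comm]; exact hs kp⟩
  let A : ι₁ → Set ℝ := fun p =>
    {s | (∀ j, e₁ p ξ - d₁ p * s < e₁ j ξ - d₁ j * s ∨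
      p ≤ j ∧ e₁ p ξ - d₁ p * s = e₁ j ξ - d₁ j * s) ∧
      ∀ q, e₂ q ξ - d₂ q * s ≤ e₁ p ξ - d₁ p * s}
  let B : ι₂ → Set ℝ := fun q =>
    {s | (∀ j, -(e₂ q ξ - d₂ q * s) < -(e₂ j ξ - d₂ j * s) ∨
      q ≤ j ∧ -(e₂ q ξ - d₂ q * s) = -(e₂ j ξ - d₂ j * s)) ∧
      ∀ p, e₂ q ξ - d₂ q * s ≤ e₁ p ξ - d₁ p * s}
  have hlt : ∀ g h : ℝ → ℝ, Continuous g → Continuous h → MeasurableSet {s | g s < h s} :=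
    fun g h hg hh => measurableSet_lt hg.measurable hh.measurable
  have hle : ∀ g h : ℝ → ℝ, Continuous g → Continuous h → MeasurableSet {s | g s ≤ h s} :=
    fun g h hg hh => measurableSet_le hg.measurable hh.measurable
  have heq : ∀ g h : ℝ → ℝ, Continuous g → Continuous h → MeasurableSet {s | g s = h s} :=
    fun g h hg hh => measurableSet_eq_fun hg.measurable hh.measurable
  have hA : ∀ p, MeasurableSet (A p) := fun p => by
    simp only [A, ofPred_and, ofPred_or, ofPred_forall]
    exact (MeasurableSet.iInter fun j => (hlt _ _ (by fun_prop) (by fun_prop)).union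
      ((MeasurableSet.const _).inter (heq _ _ (by fun_prop) (by fun_prop)))).inter
      (MeasurableSet.iInter fun j => hle _ _ (by fun_prop) (by fun_prop))
  have hB : ∀ q, MeasurableSet (B q) := fun p => by
    simp only [B, ofPred_and, ofPred_or, ofPred_forall]
    exact (MeasurableSet.iInter fun j => (hlt _ _ (by fun_prop) (by fun_prop)).union
      ((MeasurableSet.const _).inter (heq _ _ (by fun_prop) (by fun_prop)))).inter
      (MeasurableSet.iInter fun j => hle _ _ (by fun_prop) (by fun_prop))
  have h_int : ∀ d e, IntegrableOn (fun s => sliceprim ψ s (e - d * s)) S := fun d e =>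
    ((hRc d e).integrableOn_Icc).mono_set hSsub
  have hslice : ∀ s, ∫ r in {r | (∀ p, r ≤ e₁ p ξ - d₁ p * s) ∧ ∀ q, e₂ q ξ - d₂ q * s ≤ r},
      ψ s r = (∑ p, (A p).indicator (fun s => sliceprim ψ s (e₁ p ξ - d₁ p * s)) s) -
        ∑ q, (B q).indicator (fun s => sliceprim ψ s (e₂ q ξ - d₂ q * s)) s := fun s => by
    rw [setIntegral_between (fun p => e₁ p ξ - d₁ p * s) (fun q => e₂ q ξ - d₂ q * s)
      (h := ψ s) (hψ.comp (by fun_prop : Continuous fun x => (s, x)))]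
    simp only [A, B, indicator_apply, mem_ofPred_eq, sliceprim]
  simp_rw [hslice]
  rw [integral_sub
      (integrable_finsetSum _ fun p _ => (h_int (d₁ p) (e₁ p ξ)).integrable.indicator (hA p))
      (integrable_finsetSum _ fun q _ => (h_int (d₂ q) (e₂ q ξ)).integrable.indicator (hB q)),
    integral_finsetSum _ fun p _ => (h_int (d₁ p) (e₁ p ξ)).integrable.indicator (hA p),
    integral_finsetSum _ fun q _ => (h_int (d₂ q) (e₂ q ξ)).integrable.indicator (hB q)]
  congr 1
  · refine Finset.sum_congr rfl fun p _ => ?_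
    rw [setIntegral_indicator (hA p)]
    congr 2
    refine Set.ext fun s => ?_
    have h1 : ∀ j, (d₁ j - d₁ p) * s < e₁ j ξ - e₁ p ξ ↔
        e₁ p ξ - d₁ p * s < e₁ j ξ - d₁ j * s := fun j => by
      constructor <;> intro h <;> linarith
    have h2 : ∀ j, (d₁ j - d₁ p) * s = e₁ j ξ - e₁ p ξ ↔
        e₁ p ξ - d₁ p * s = e₁ j ξ - d₁ j * s := fun j => by
      constructor <;> intro h <;> linarith
    have h3 : ∀ q, (d₁ p - d₂ q) * s ≤ e₁ p ξ - e₂ q ξ ↔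
        e₂ q ξ - d₂ q * s ≤ e₁ p ξ - d₁ p * s := fun j => by
      constructor <;> intro h <;> linarith
    simp only [S, A, mem_inter_iff, mem_ofPred_eq, Sum.forall, Sum.elim_inl, Sum.elim_inr,
      true_and, ← le_iff_lt_or_eq, h1, h2, h3]
  · refine Finset.sum_congr rfl fun q _ => ?_
    rw [setIntegral_indicator (hB q)]
    congr 2
    refine Set.ext fun s => ?_
    have h1 : ∀ j, (d₂ q - d₂ j) * s < e₂ q ξ - e₂ j ξ ↔
        -(e₂ q ξ - d₂ q * s) < -(e₂ j ξ - d₂ j * s) := fun j => by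
      constructor <;> intro h <;> linarith
    have h2 : ∀ j, (d₂ q - d₂ j) * s = e₂ q ξ - e₂ j ξ ↔
        -(e₂ q ξ - d₂ q * s) = -(e₂ j ξ - d₂ j * s) := fun j => by
      constructor <;> intro h <;> linarith
    have h3 : ∀ p, (d₁ p - d₂ q) * s ≤ e₁ p ξ - e₂ q ξ ↔
        e₂ q ξ - d₂ q * s ≤ e₁ p ξ - d₁ p * s := fun j => by
      constructor <;> intro h <;> linarith
    simp only [S, B, mem_inter_iff, mem_ofPred_eq, Sum.forall, Sum.elim_inl, Sum.elim_inr,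
      true_and, ← le_iff_lt_or_eq, h1, h2, h3]

end Slices

/-! ### Fubini in orthonormal coordinates. -/

section Coordinates

theorem measurePreserving_coords (b : OrthonormalBasis (Fin 2) ℝ Plane) :
    MeasurePreserving (fun p : ℝ × ℝ => p.1 • b 0 + p.2 • b 1) volume volume ∧
      MeasurableEmbedding fun p : ℝ × ℝ => p.1 • b 0 + p.2 • b 1 := by
  have h : (fun p : ℝ × ℝ => p.1 • b 0 + p.2 • b 1) =
      b.repr.symm ∘ WithLp.toLp 2 ∘ (MeasurableEquiv.finTwoArrow (α := ℝ)).symm := by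
    funext p
    simp [← b.sum_repr_symm, Fin.sum_univ_two, MeasurableEquiv.finTwoArrow]
  rw [h]
  refine ⟨b.measurePreserving_repr_symm.comp ((PiLp.volume_preserving_toLp (Fin 2)).comp
    (volume_preserving_finTwoArrow ℝ).symm), ?_⟩
  exact b.repr.symm.toHomeomorph.measurableEmbedding.comp
    ((MeasurableEquiv.toLp 2 (Fin 2 → ℝ)).measurableEmbedding.comp
      (MeasurableEquiv.finTwoArrow (α := ℝ)).symm.measurableEmbedding)

/-- Integration in the coordinates of an orthonormal basis. -/
theorem integral_coords (b : OrthonormalBasis (Fin 2) ℝ Plane) {F : Plane → ℝ}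
    (hF : Integrable F) :
    ∫ x, F x = ∫ s : ℝ, ∫ r : ℝ, F (s • b 0 + r • b 1) := by
  obtain ⟨h1, h2⟩ := measurePreserving_coords b
  rw [← h1.integral_comp h2, Measure.volume_eq_prod, integral_prod]
  rw [← Measure.volume_eq_prod]
  exact (h1.integrable_comp_emb h2).2 hF

end Coordinates

/-! ### Integrals over polygons as functions of the edge offsets. -/

section Polygon

variable {ι : Type*}

/-- The intersection of the half-planes `⟪l m, x⟫ ≤ t m`. -/
def halfplanes (l : ι → Plane) (t : ι → ℝ) : Set Plane := {x | ∀ m, inner ℝ (l m) x ≤ t m}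

theorem isClosed_halfplanes (l : ι → Plane) (t : ι → ℝ) : IsClosed (halfplanes l t) := by
  simp only [halfplanes, ofPred_forall]
  exact isClosed_iInter fun m => isClosed_le (by fun_prop) continuous_const

/-- The integral over a polygon with fixed normal directions depends piecewise `C¹` on the
offsets of the edges. -/
theorem isC1Selection_halfplanes {E : Type*} [NormedAddCommGroup E] [NormedSpace ℝ E] [Fintype ι]
    (l : ι → Plane) {e : ι → E → ℝ} (he : ∀ m, ContDiff ℝ 1 (e m)) {ψ : Plane → ℝ}
    (hψ : Continuous ψ) (hcs : HasCompactSupport ψ) :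
    IsC1Selection fun ξ => ∫ x in halfplanes l fun m => e m ξ, ψ x := by
  classical
  let b := EuclideanSpace.basisFun (Fin 2) ℝ
  have hb : ∀ m s r, inner ℝ (l m) (s • b 0 + r • b 1) = l m 0 * s + l m 1 * r := fun m s r => by
    simp [b, inner_add_right, inner_smul_right, EuclideanSpace.inner_single_right, mul_comm]
  obtain ⟨C, hC⟩ := hcs.exists_bound_of_continuous hψ
  obtain ⟨B, hB⟩ := hcs.isCompact.isBounded.subset_closedBall 0
  have hbox : ∀ s r, ψ (s • b 0 + r • b 1) ≠ 0 → (s ≤ B ∧ -B ≤ s) ∧ r ≤ B ∧ -B ≤ r := by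
    intro s r h
    have h1 := hB (subset_tsupport _ (Function.mem_support.2 h))
    rw [mem_closedBall_zero_iff] at h1
    have h2 := (PiLp.norm_apply_le (s • b 0 + r • b 1) 0).trans h1
    have h3 := (PiLp.norm_apply_le (s • b 0 + r • b 1) 1).trans h1
    simp only [b, Real.norm_eq_abs, abs_le, EuclideanSpace.basisFun_apply, PiLp.add_apply,
      PiLp.smul_apply, smul_eq_mul, PiLp.single_apply] at h2 h3
    simp at h2 h3
    exact ⟨⟨h2.2, by linarith⟩, h3.2, by linarith⟩
  -- The orders are arbitrary; they serve only to break ties.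
  let o₁ : LinearOrder (Option {m // 0 < l m 1}) :=
    LinearOrder.lift' (Fintype.equivFin _) (Equiv.injective _)
  let o₂ : LinearOrder (Option {m // l m 1 < 0}) :=
    LinearOrder.lift' (Fintype.equivFin _) (Equiv.injective _)
  -- The sign of `l m 1` decides whether constraint `m` bounds `r` above, below, or restricts `s`
  -- alone. The extra indices `none` and `Bool` add a box `[-B, B]²` containing the support of `ψ`:
  -- it leaves the integral unchanged and supplies the bounds that may otherwise be missing.
  have key := isC1Selection_between (E := E) (ι₁ := Option {m // 0 < l m 1})
    (ι₂ := Option {m // l m 1 < 0}) (ι₃ := Bool ⊕ {m // l m 1 = 0})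
    (ψ := fun s r => ψ (s • b 0 + r • b 1))
    (hψ.comp (by fun_prop : Continuous fun p : ℝ × ℝ => p.1 • b 0 + p.2 • b 1))
    (fun s r => hC _)
    (d₁ := fun p => p.elim 0 fun m => l m 0 / l m 1)
    (e₁ := fun p => p.elim (fun _ => B) fun m ξ => e m ξ / l m 1)
    (by rintro (_ | m); exacts [contDiff_const, (he m).div_const _])
    (d₂ := fun p => p.elim 0 fun m => l m 0 / l m 1)
    (e₂ := fun p => p.elim (fun _ => -B) fun m ξ => e m ξ / l m 1)
    (by rintro (_ | m); exacts [contDiff_const, (he m).div_const _])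
    (κ := Sum.elim (fun i => if i then 1 else -1) fun m => l m 0)
    (f := Sum.elim (fun _ _ => B) fun m => e m)
    (by rintro (_ | m); exacts [contDiff_const, he m])
    ⟨Sum.inl true, by simp⟩ ⟨Sum.inl false, by simp⟩
  convert key using 2 with ξ
  have hmeas := (isClosed_halfplanes l fun m => e m ξ).measurableSet
  rw [← integral_indicator hmeas,
    integral_coords b ((hψ.integrable_of_hasCompactSupport hcs).indicator hmeas)]
  rw [← integral_indicator]
  swap
  · simp only [ofPred_forall]
    exact MeasurableSet.iInter fun k => measurableSet_le (by fun_prop) measurable_const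
  refine integral_congr_ae (Eventually.of_forall fun s => ?_)
  have hiff : ∀ r,
      (s • b 0 + r • b 1 ∈ halfplanes l (fun m => e m ξ) ↔
        (∀ m, l m 1 = 0 → l m 0 * s ≤ e m ξ) ∧
        (∀ m, 0 < l m 1 → r ≤ e m ξ / l m 1 - l m 0 / l m 1 * s) ∧
        ∀ m, l m 1 < 0 → e m ξ / l m 1 - l m 0 / l m 1 * s ≤ r) := by
    intro r
    have h1 : ∀ m, 0 < l m 1 → (r ≤ e m ξ / l m 1 - l m 0 / l m 1 * s ↔
        l m 0 * s + l m 1 * r ≤ e m ξ) := fun m hm => by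
      rw [div_mul_eq_mul_div, ← sub_div, le_div_iff₀ hm]
      constructor <;> intro h <;> linarith
    have h2 : ∀ m, l m 1 < 0 → (e m ξ / l m 1 - l m 0 / l m 1 * s ≤ r ↔
        l m 0 * s + l m 1 * r ≤ e m ξ) := fun m hm => by
      rw [div_mul_eq_mul_div, ← sub_div, div_le_iff_of_neg hm]
      constructor <;> intro h <;> linarith
    simp only [halfplanes, mem_ofPred_eq, hb]
    constructor
    · intro h
      refine ⟨fun m hm => ?_, fun m hm => (h1 m hm).2 (h m), fun m hm => (h2 m hm).2 (h m)⟩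
      simpa [hm] using h m
    · rintro ⟨ha, hb', hc⟩ m
      rcases lt_trichotomy (l m 1) 0 with hm | hm | hm
      · exact (h2 m hm).1 (hc m hm)
      · simpa [hm] using ha m hm
      · exact (h1 m hm).1 (hb' m hm)
  by_cases hs : ∀ k : Bool ⊕ {m // l m 1 = 0},
      (Sum.elim (fun i => if i then 1 else -1) (fun m : {m // l m 1 = 0} => l m 0) k : ℝ) * s ≤
        Sum.elim (fun _ _ => B) (fun m : {m // l m 1 = 0} => e m) k ξ
  · rw [indicator_of_mem (by exact hs), ← integral_indicator]
    swap
    · simp only [ofPred_and, ofPred_forall]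
      exact (MeasurableSet.iInter fun k => measurableSet_le measurable_id measurable_const).inter
        (MeasurableSet.iInter fun k => measurableSet_le measurable_const measurable_id)
    refine integral_congr_ae (Eventually.of_forall fun r => ?_)
    dsimp only
    by_cases h0 : ψ (s • b 0 + r • b 1) = 0
    · rw [indicator_apply, indicator_apply, h0, ite_self, ite_self]
    · have hvert : ∀ m, l m 1 = 0 → l m 0 * s ≤ e m ξ := fun m hm => hs (Sum.inr ⟨m, hm⟩)
      have hbx := hbox s r h0
      rw [indicator_apply, indicator_apply]
      refine if_congr ((hiff r).trans ?_) rfl rfl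
      simp only [mem_ofPred_eq, Option.forall, Option.elim_none, Option.elim_some, Subtype.forall,
        zero_mul, sub_zero]
      exact ⟨fun h => ⟨⟨hbx.2.1, h.2.1⟩, hbx.2.2, h.2.2⟩, fun h => ⟨hvert, h.1.2, h.2.2⟩⟩
  · rw [indicator_of_notMem (by exact hs)]
    refine integral_eq_zero_of_ae (Eventually.of_forall fun r => ?_)
    refine indicator_apply_eq_zero.2 fun hmem => ?_
    by_contra h0
    refine hs ?_
    rintro (i | ⟨m, hm⟩)
    · have hbx := (hbox s r h0).1
      cases i
      · simp; linarith
      · simpa using hbx.1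
    · exact ((hiff r).1 hmem).1 m hm

end Polygon

/-! ### Differentiability from continuous partial derivatives. -/

section Partials

/-- A function of finitely many real variables whose partial derivatives exist near a point and are
continuous at that point is differentiable there. -/
theorem hasFDerivAt_of_partials {T : Type*} [Fintype T] [DecidableEq T] {f : (T → ℝ) → ℝ}
    {p : T → (T → ℝ) → ℝ} {t₀ : T → ℝ}
    (hd : ∀ k, ∀ᶠ t in 𝓝 t₀, HasDerivAt (fun σ => f (Function.update t k σ)) (p k t) (t k))
    (hp : ∀ k, ContinuousAt (p k) t₀) :
    HasFDerivAt f (∑ k, p k t₀ • ContinuousLinearMap.proj (R := ℝ) (φ := fun _ : T => ℝ) k)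
      t₀ := by
  rw [hasFDerivAt_iff_isLittleO]
  refine Asymptotics.IsLittleO.of_bound fun ε hε => ?_
  -- Each coordinate costs at most `ε' * ‖t - t₀‖`; the `+ 1` covers empty `T`.
  set ε' := ε / (Fintype.card T + 1) with hε'
  have hε'0 : 0 < ε' := by positivity
  obtain ⟨δ, hδ, hball⟩ := Metric.eventually_nhds_iff.1 ((eventually_all.2 hd).and
    (eventually_all.2 fun k => Metric.tendsto_nhds.1 (hp k) ε' hε'0))
  filter_upwards [Metric.ball_mem_nhds t₀ hδ] with t ht
  have ht' : ∀ j, dist (t j) (t₀ j) < δ := (dist_pi_lt_iff hδ).1 ht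
  -- Coordinates are moved from `t₀` to `t` one at a time; `s` holds those already moved. Each move
  -- is estimated by the mean value inequality after subtracting the linear term.
  have claim : ∀ s : Finset T, ‖f (s.piecewise t t₀) - f t₀ - ∑ k ∈ s, p k t₀ * (t k - t₀ k)‖ ≤
      s.card * (ε' * ‖t - t₀‖) := by
    intro s
    induction s using Finset.induction_on with
    | empty => simp
    | insert k s hk ih =>
      set w := s.piecewise t t₀ with hw
      have hwk : w k = t₀ k := Finset.piecewise_eq_of_notMem _ _ _ hk
      have hmem : ∀ σ ∈ uIcc (t₀ k) (t k), dist (Function.update w k σ) t₀ < δ := by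
        intro σ hσ
        refine (dist_pi_lt_iff hδ).2 fun j => ?_
        by_cases hj : j = k
        · subst hj
          rw [Function.update_self, Real.dist_eq]
          exact (abs_sub_left_of_mem_uIcc hσ).trans_lt (ht' j)
        · rw [Function.update_of_ne hj, hw]
          by_cases hjs : j ∈ s
          · rw [Finset.piecewise_eq_of_mem _ _ _ hjs]; exact ht' j
          · rw [Finset.piecewise_eq_of_notMem _ _ _ hjs, dist_self]; exact hδ
      have hmv := Convex.norm_image_sub_le_of_norm_hasDerivWithin_le
        (f := fun σ => f (Function.update w k σ) - σ * p k t₀)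
        (f' := fun σ => p k (Function.update w k σ) - 1 * p k t₀) (s := uIcc (t₀ k) (t k))
        (x := t₀ k) (y := t k) (C := ε')
        (fun σ hσ => by
          have h := (hball (hmem σ hσ)).1 k
          simp only [Function.update_idem, Function.update_self] at h
          exact (h.sub ((hasDerivAt_id σ).mul_const _)).hasDerivWithinAt)
        (fun σ hσ => by
          have h := (hball (hmem σ hσ)).2 k
          rw [Real.dist_eq] at h
          rw [one_mul]
          exact h.le)
        (convex_uIcc _ _) left_mem_uIcc right_mem_uIcc
      rw [Finset.piecewise_insert, Finset.sum_insert hk, Finset.card_insert_of_notMem hk]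
      have hup : Function.update w k (t₀ k) = w := by rw [← hwk, Function.update_eq_self]
      rw [hup] at hmv
      have hle : ε' * ‖t k - t₀ k‖ ≤ ε' * ‖t - t₀‖ := by
        gcongr
        exact norm_le_pi_norm (t - t₀) k
      have heq : f (Function.update w k (t k)) - f t₀ -
          (p k t₀ * (t k - t₀ k) + ∑ k ∈ s, p k t₀ * (t k - t₀ k)) =
          (f (Function.update w k (t k)) - t k * p k t₀ - (f w - t₀ k * p k t₀)) +
          (f w - f t₀ - ∑ k ∈ s, p k t₀ * (t k - t₀ k)) := by ring
      rw [heq]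
      push_cast
      calc _ ≤ ε' * ‖t - t₀‖ + s.card * (ε' * ‖t - t₀‖) :=
            (norm_add_le _ _).trans (add_le_add (hmv.trans hle) ih)
        _ = _ := by ring
  have hfin := claim Finset.univ
  rw [Finset.piecewise_univ] at hfin
  have hlin : (∑ k, p k t₀ • ContinuousLinearMap.proj (R := ℝ) (φ := fun _ : T => ℝ) k) (t - t₀) =
      ∑ k, p k t₀ * (t k - t₀ k) := by
    simp
  rw [hlin]
  refine hfin.trans ?_
  rw [← mul_assoc]
  gcongr
  rw [hε', Finset.card_univ, mul_div_assoc', div_le_iff₀ (by positivity)]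
  nlinarith

end Partials

/-! ### Continuity of integrals over sets cut out by inequalities. -/

section ContinuityOfIntegrals

/-- Continuity of the integral over a set that is cut out by inequalities, none of which is an
equality on a set of positive measure. -/
theorem continuousAt_setIntegral_constraints {X Ω ι : Type*} [TopologicalSpace X]
    [FirstCountableTopology X] [MeasurableSpace Ω] {μ : Measure Ω} [Finite ι]
    {g : ι → X → Ω → ℝ} {F : X → Ω → ℝ} {x₀ : X} {bound : Ω → ℝ}
    (hg : ∀ m x, Measurable (g m x)) (hF : ∀ x, AEStronglyMeasurable (F x) μ)
    (hb : ∀ᶠ x in 𝓝 x₀, ∀ ω, ‖F x ω‖ ≤ bound ω) (hbi : Integrable bound μ)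
    (hne : ∀ m, ∀ᵐ ω ∂μ, g m x₀ ω ≠ 0) (hgc : ∀ m ω, ContinuousAt (fun x => g m x ω) x₀)
    (hFc : ∀ ω, ContinuousAt (fun x => F x ω) x₀) :
    ContinuousAt (fun x => ∫ ω in {ω | ∀ m, g m x ω ≤ 0}, F x ω ∂μ) x₀ := by
  have hmeas : ∀ x, MeasurableSet {ω | ∀ m, g m x ω ≤ 0} := fun x => by
    simp only [ofPred_forall]
    exact MeasurableSet.iInter fun m => measurableSet_le (hg m x) measurable_const
  simp_rw [← fun x => integral_indicator (μ := μ) (f := F x) (hmeas x)]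
  refine tendsto_integral_filter_of_dominated_convergence bound
    (Eventually.of_forall fun x => (hF x).indicator (hmeas x)) ?_ hbi ?_
  · filter_upwards [hb] with x hx
    exact Eventually.of_forall fun ω => (norm_indicator_le_norm_self _ _).trans (hx ω)
  · filter_upwards [ae_all_iff.2 hne] with ω hω
    -- At almost every `ω` no constraint is tight at `x₀`, so membership of `ω` in the set is
    -- constant for `x` near `x₀`.
    by_cases h : ∀ m, g m x₀ ω ≤ 0
    · have hev : ∀ᶠ x in 𝓝 x₀, ∀ m, g m x ω ≤ 0 := eventually_all.2 fun m =>
        ((hgc m ω).eventually (Iio_mem_nhds ((h m).lt_of_ne (hω m)))).mono fun x hx => le_of_lt hx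
      rw [indicator_of_mem (by exact h)]
      refine (hFc ω).tendsto.congr' ?_
      filter_upwards [hev] with x hx
      rw [indicator_of_mem (by exact hx)]
    · rw [indicator_of_notMem (by exact h)]
      push Not at h
      obtain ⟨m, hm⟩ := h
      refine tendsto_const_nhds.congr' ?_
      filter_upwards [(hgc m ω).eventually (Ioi_mem_nhds hm)] with x hx
      rw [indicator_of_notMem]
      exact fun hc => (not_le.2 hx) (hc m)

theorem ae_inner_ne {v : Plane} (hv : v ≠ 0) (c : ℝ) : ∀ᵐ x : Plane, inner ℝ v x ≠ c := by
  have hc : c = inner ℝ v ((c / ‖v‖ ^ 2) • v) := by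
    rw [inner_smul_right, real_inner_self_eq_norm_sq]
    field_simp [norm_ne_zero_iff.2 hv]
  have hset : {x : Plane | ¬ inner ℝ v x ≠ c} =
      (fun x => x + (-((c / ‖v‖ ^ 2) • v))) ⁻¹' (((innerSL ℝ v : Plane →L[ℝ] ℝ) :
        Plane →ₗ[ℝ] ℝ).ker : Set Plane) := by
    refine Set.ext fun x => ?_
    simp only [ne_eq, not_not, mem_ofPred_eq, mem_preimage, SetLike.mem_coe, LinearMap.mem_ker]
    rw [← sub_eq_add_neg]
    simp only [ContinuousLinearMap.coe_coe, map_sub, innerSL_apply_apply, ← hc, sub_eq_zero]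
  rw [ae_iff, hset, measure_preimage_add_right]
  refine Measure.addHaar_submodule volume _ fun htop => ?_
  have : v ∈ (((innerSL ℝ v : Plane →L[ℝ] ℝ) : Plane →ₗ[ℝ] ℝ).ker) := by
    rw [htop]; trivial
  simp at this
  exact hv this

variable {ι : Type*} [Finite ι] {ψ : Plane → ℝ}

theorem continuous_integral_halfplanes (hψ : Continuous ψ) (hcs : HasCompactSupport ψ)
    {l : ι → Plane} (hl : ∀ m, l m ≠ 0) :
    Continuous fun t : ι → ℝ => ∫ x in halfplanes l t, ψ x := by
  cases nonempty_fintype ι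
  refine continuous_iff_continuousAt.2 fun t => ?_
  have h := continuousAt_setIntegral_constraints (μ := volume) (x₀ := t)
    (g := fun m (t : ι → ℝ) x => inner ℝ (l m) x - t m) (F := fun _ => ψ)
    (bound := fun x => ‖ψ x‖) (fun m t => by fun_prop)
    (fun _ => hψ.aestronglyMeasurable) (Eventually.of_forall fun _ _ => le_rfl)
    (hψ.integrable_of_hasCompactSupport hcs).norm
    (fun m => (ae_inner_ne (hl m) (t m)).mono fun x hx => sub_ne_zero.2 hx)
    (fun m x => (by fun_prop : Continuous fun t : ι → ℝ => inner ℝ (l m) x - t m).continuousAt)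
    (fun x => continuousAt_const)
  simpa only [sub_nonpos] using! h

end ContinuityOfIntegrals

/-! ### Derivatives with respect to edge offsets as edge integrals. -/

section Slices

variable {ι : Type*} {ψ : Plane → ℝ}

/-- The integral of `ψ` over the part of the line `{s • b 0 + r • b 1 | r}` that satisfies all
constraints other than the `k`-th. -/
noncomputable def sliceIntegral (ψ : Plane → ℝ) (b : OrthonormalBasis (Fin 2) ℝ Plane)
    (l : ι → Plane) (k : ι) (s : ℝ) (t : ι → ℝ) : ℝ :=
  ∫ r in {r : ℝ | ∀ m : {m // m ≠ k}, inner ℝ (l m) (s • b 0 + r • b 1) - t m ≤ 0},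
    ψ (s • b 0 + r • b 1)

theorem exists_orthonormalBasis_first {v : Plane} (hv : v ≠ 0) :
    ∃ b : OrthonormalBasis (Fin 2) ℝ Plane, v = ‖v‖ • b 0 := by
  obtain ⟨b, hb⟩ := Orthonormal.exists_orthonormalBasis_extension_of_card_eq (𝕜 := ℝ)
    (E := Plane) (ι := Fin 2) (by simp) (v := fun _ => ‖v‖⁻¹ • v) (s := {0})
    (by
      refine ⟨fun i => ?_, fun i j hij => (hij (Subsingleton.elim _ _)).elim⟩
      simp [norm_smul, hv])
  refine ⟨b, ?_⟩
  rw [hb 0 rfl, smul_smul, mul_inv_cancel₀ (norm_ne_zero_iff.2 hv), one_smul]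

theorem inner_first {v : Plane} {b : OrthonormalBasis (Fin 2) ℝ Plane} (hb : v = ‖v‖ • b 0)
    (s r : ℝ) : inner ℝ v (s • b 0 + r • b 1) = ‖v‖ * s := by
  rw [hb, inner_add_right, inner_smul_right, inner_smul_right, real_inner_smul_left,
    real_inner_smul_left, b.inner_eq_one, b.inner_eq_zero (by decide : (0 : Fin 2) ≠ 1), norm_smul]
  simp [mul_comm]

/-- Slice integrals are continuous where no other constraint line coincides with the slice. -/
theorem continuousAt_sliceIntegral [Finite ι] (hψ : Continuous ψ) (hcs : HasCompactSupport ψ)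
    {l : ι → Plane} {k : ι} (hk : l k ≠ 0) {b : OrthonormalBasis (Fin 2) ℝ Plane}
    (hb : l k = ‖l k‖ • b 0) {t : ι → ℝ}
    (hne : ∀ m ≠ k, ∀ c : ℝ, l m = c • l k → c * t k ≠ t m) :
    ContinuousAt (fun p : ℝ × (ι → ℝ) => sliceIntegral ψ b l k p.1 p.2) (t k / ‖l k‖, t) := by
  cases nonempty_fintype ι
  obtain ⟨C, hC⟩ := hcs.exists_bound_of_continuous hψ
  obtain ⟨B, hB⟩ := hcs.isCompact.isBounded.subset_closedBall 0
  have hbox : ∀ s r : ℝ, ψ (s • b 0 + r • b 1) ≠ 0 → r ∈ Icc (-B) B := by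
    intro s r h
    have h1 := hB (subset_tsupport _ (Function.mem_support.2 h))
    rw [mem_closedBall_zero_iff] at h1
    have h2 := (abs_real_inner_le_norm (b 1) (s • b 0 + r • b 1)).trans
      (mul_le_mul_of_nonneg_left h1 (norm_nonneg _))
    rw [inner_add_right, inner_smul_right, inner_smul_right, b.inner_eq_one,
      b.inner_eq_zero (by decide : (1 : Fin 2) ≠ 0), b.norm_eq_one] at h2
    simpa [abs_le] using h2
  have hk0 : ‖l k‖ ≠ 0 := norm_ne_zero_iff.2 hk
  refine continuousAt_setIntegral_constraints
    (g := fun (m : {m // m ≠ k}) (p : ℝ × (ι → ℝ)) (r : ℝ) =>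
      inner ℝ (l m) (p.1 • b 0 + r • b 1) - p.2 m)
    (F := fun p r => ψ (p.1 • b 0 + r • b 1)) (bound := (Icc (-B) B).indicator fun _ => C)
    (fun m p => by fun_prop) (fun p => ?_) (Eventually.of_forall fun p r => ?_) ?_
    (fun m => ?_) (fun m r => by fun_prop) (fun r => ?_)
  · exact (hψ.comp (by fun_prop)).aestronglyMeasurable
  · rw [indicator_apply]
    split_ifs with h
    · exact hC _
    · rw [norm_le_zero_iff]
      by_contra h0
      exact h (hbox _ _ h0)
  · exact (integrable_indicator_iff measurableSet_Icc).2 (by simp)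
  -- A constraint parallel to the slice is constant in `r`, and `hne` says that this constant is not
  -- zero. Any other constraint is tight at a single `r`.
  · by_cases hm : inner ℝ (l m) (b 1) = 0
    · have hpar : l m = (inner ℝ (b 0) (l m) / ‖l k‖) • l k := by
        rw [hb, smul_smul, norm_smul, b.norm_eq_one, mul_one, norm_norm, div_mul_cancel₀ _ hk0]
        have h := b.sum_repr' (l m)
        rw [Fin.sum_univ_two, real_inner_comm (l m) (b 1), hm, zero_smul, add_zero] at h
        exact h.symm
      have h := hne m m.2 _ hpar
      refine Eventually.of_forall fun r => ?_
      rw [sub_ne_zero, inner_add_right, inner_smul_right, inner_smul_right, hm,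
        real_inner_comm (b 0) (l m)]
      intro heq
      refine h ?_
      dsimp only at heq
      rw [← heq]
      ring
    · have hfin : ∀ᵐ r : ℝ, r ≠ (t m - t k / ‖l k‖ * inner ℝ (l m) (b 0)) / inner ℝ (l m) (b 1) :=
        Measure.ae_ne volume _
      filter_upwards [hfin] with r hr h0
      refine hr ?_
      rw [inner_add_right, inner_smul_right, inner_smul_right, sub_eq_zero] at h0
      rw [eq_div_iff hm, ← h0]
      ring
  · exact (hψ.comp (by fun_prop : Continuous fun p : ℝ × (ι → ℝ) =>
      p.1 • b 0 + r • b 1)).continuousAt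

/-- In a basis whose first vector points along `l k`, constraint `k` reads `s ≤ σ / ‖l k‖` and the
slices do not depend on `σ`. Fubini and the fundamental theorem give the slice integral; the factor
`1 / ‖l k‖` is the inner derivative. -/
theorem hasDerivAt_integral_halfplanes [Finite ι] [DecidableEq ι] (hψ : Continuous ψ)
    (hcs : HasCompactSupport ψ) {l : ι → Plane} {k : ι} (hk : l k ≠ 0)
    {b : OrthonormalBasis (Fin 2) ℝ Plane} (hb : l k = ‖l k‖ • b 0) {t : ι → ℝ}
    (hne : ∀ m ≠ k, ∀ c : ℝ, l m = c • l k → c * t k ≠ t m) :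
    HasDerivAt (fun σ => ∫ x in halfplanes l (Function.update t k σ), ψ x)
      (1 / ‖l k‖ * sliceIntegral ψ b l k (t k / ‖l k‖) t) (t k) := by
  classical
  have hk0 : 0 < ‖l k‖ := norm_pos_iff.2 hk
  set P : Set Plane := halfplanes (fun m : {m // m ≠ k} => l m) fun m => t m with hP
  have hPm : MeasurableSet P := (isClosed_halfplanes _ _).measurableSet
  have hψi : Integrable ψ := hψ.integrable_of_hasCompactSupport hcs
  obtain ⟨h1, h2⟩ := measurePreserving_coords b
  have hslice : ∀ s, sliceIntegral ψ b l k s t = ∫ r : ℝ, P.indicator ψ (s • b 0 + r • b 1) := by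
    intro s
    have hc : Continuous fun r : ℝ => s • b 0 + r • b 1 := by fun_prop
    have hset : {r : ℝ | ∀ m : {m // m ≠ k}, inner ℝ (l m) (s • b 0 + r • b 1) - t m ≤ 0} =
        (fun r : ℝ => s • b 0 + r • b 1) ⁻¹' P := by
      refine Set.ext fun r => ?_
      simp [hP, halfplanes]
    rw [sliceIntegral, hset, ← integral_indicator (hc.measurable hPm)]
    rfl
  have hHi : Integrable fun s => sliceIntegral ψ b l k s t := by
    simp_rw [hslice]
    have := (h1.integrable_comp_emb h2).2 (hψi.indicator hPm)
    rw [Measure.volume_eq_prod] at this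
    exact this.integral_prod_left
  have hV : ∀ σ, ∫ x in halfplanes l (Function.update t k σ), ψ x =
      ∫ s in Iic (σ / ‖l k‖), sliceIntegral ψ b l k s t := by
    intro σ
    have hm : MeasurableSet (halfplanes l (Function.update t k σ)) :=
      (isClosed_halfplanes _ _).measurableSet
    rw [← integral_indicator hm, integral_coords b (hψi.indicator hm),
      ← integral_indicator measurableSet_Iic]
    refine integral_congr_ae (Eventually.of_forall fun s => ?_)
    have hiff : ∀ r : ℝ, s • b 0 + r • b 1 ∈ halfplanes l (Function.update t k σ) ↔
        s ≤ σ / ‖l k‖ ∧ s • b 0 + r • b 1 ∈ P := by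
      intro r
      rw [le_div_iff₀ hk0, mul_comm s, ← inner_first hb s r]
      simp only [halfplanes, hP, mem_ofPred_eq, Subtype.forall]
      constructor
      · intro h
        refine ⟨by simpa using h k, fun m hmk => by simpa [hmk] using h m⟩
      · rintro ⟨h1, h2⟩ m
        by_cases hmk : m = k
        · subst hmk; simpa using h1
        · simpa [hmk] using h2 m hmk
    dsimp only
    by_cases hs : s ≤ σ / ‖l k‖
    · rw [indicator_of_mem (by exact hs), hslice]
      congr 1
      funext r
      simp only [indicator_apply, hiff, hs, true_and]
    · rw [indicator_of_notMem (by exact hs)]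
      simp only [indicator_apply, hiff, hs, false_and, if_false, integral_zero]
  simp_rw [hV]
  have hcont : ContinuousAt (fun s => sliceIntegral ψ b l k s t) (t k / ‖l k‖) :=
    (continuousAt_sliceIntegral hψ hcs hk hb hne).comp_of_eq
      (f := fun s : ℝ => (s, t)) (by fun_prop) rfl
  have hder : HasDerivAt (fun x => ∫ s in Iic x, sliceIntegral ψ b l k s t)
      (sliceIntegral ψ b l k (t k / ‖l k‖) t) (t k / ‖l k‖) := by
    have h := intervalIntegral.integral_hasDerivAt_right (a := 0)
      hHi.intervalIntegrable hHi.aestronglyMeasurable.stronglyMeasurableAtFilter hcont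
    have heq : (fun x => ∫ s in Iic x, sliceIntegral ψ b l k s t) = fun x =>
        (∫ s in Iic (0 : ℝ), sliceIntegral ψ b l k s t) +
          ∫ s in (0 : ℝ)..x, sliceIntegral ψ b l k s t := by
      funext x
      rw [← intervalIntegral.integral_Iic_sub_Iic hHi.integrableOn hHi.integrableOn]
      ring
    rw [heq]
    exact h.const_add _
  have hcomp := hder.comp (t k) ((hasDerivAt_id (t k)).div_const ‖l k‖)
  rw [mul_comm]
  exact hcomp

/-- A slice integral is an integral with respect to the one-dimensional Hausdorff measure. -/
theorem sliceIntegral_eq_hausdorff {l : ι → Plane} {k : ι} (hk : l k ≠ 0)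
    {b : OrthonormalBasis (Fin 2) ℝ Plane} (hb : l k = ‖l k‖ • b 0) {t : ι → ℝ} :
    sliceIntegral ψ b l k (t k / ‖l k‖) t =
      ∫ x in {x ∈ halfplanes l t | inner ℝ (l k) x = t k}, ψ x ∂Measure.hausdorffMeasure 1 := by
  have hk0 : ‖l k‖ ≠ 0 := norm_ne_zero_iff.2 hk
  set γ : ℝ → Plane := fun r => (t k / ‖l k‖) • b 0 + r • b 1 with hγ
  have hiso : Isometry γ := Isometry.of_dist_eq fun r r' => by
    rw [dist_eq_norm, dist_eq_norm, hγ]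
    simp only [add_sub_add_left_eq_sub, ← sub_smul, norm_smul, b.norm_eq_one, mul_one]
  set S := {x ∈ halfplanes l t | inner ℝ (l k) x = t k} with hS
  have hSr : S ⊆ range γ := by
    rintro x ⟨-, hx⟩
    refine ⟨inner ℝ (b 1) x, ?_⟩
    have h := b.sum_repr' x
    rw [Fin.sum_univ_two] at h
    have hx' : inner ℝ (b 0) x = t k / ‖l k‖ := by
      rw [hb, real_inner_smul_left] at hx
      rw [← hx, mul_div_cancel_left₀ _ hk0]
    rw [hγ]
    dsimp only
    rw [← hx', h]
  have hSm : MeasurableSet S := ((isClosed_halfplanes l t).inter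
    (isClosed_eq (by fun_prop) continuous_const)).measurableSet
  -- The parametrization of the line is an isometry, so it carries Lebesgue measure to Hausdorff
  -- measure on its range, which contains `S`.
  have h1 : (Measure.hausdorffMeasure 1 : Measure Plane).restrict S =
      (Measure.map γ volume).restrict S := by
    rw [← hausdorffMeasure_real, hiso.map_hausdorffMeasure (Or.inl zero_le_one),
      Measure.restrict_restrict hSm, inter_eq_left.2 hSr]
  rw [h1, hiso.isClosedEmbedding.measurableEmbedding.setIntegral_map, sliceIntegral]
  congr 2
  refine Set.ext fun r => ?_
  have hin : inner ℝ (l k) (γ r) = t k := by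
    rw [hγ, inner_first hb, mul_div_cancel₀ _ hk0]
  simp only [mem_ofPred_eq, mem_preimage, hS, halfplanes, hin, and_true, Subtype.forall, sub_nonpos]
  constructor
  · intro h m
    by_cases hm : m = k
    · subst hm; exact hin.le
    · exact h m hm
  · intro h m _
    exact h m

/-- The derivative of the integral over a polygon with respect to the offsets of some of its
edges. -/
theorem hasFDerivAt_integral_halfplanes {T κ : Type*} [Fintype T] [Finite κ]
    (hψ : Continuous ψ) (hcs : HasCompactSupport ψ) {l : T ⊕ κ → Plane} (hl : ∀ m, l m ≠ 0)
    {c : κ → ℝ} {t : T → ℝ}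
    (hne : ∀ k : T, ∀ m ≠ Sum.inl k, ∀ r : ℝ, l m = r • l (Sum.inl k) →
      r * t k ≠ (Sum.elim t c m : ℝ)) :
    HasFDerivAt (fun t : T → ℝ => ∫ x in halfplanes l (Sum.elim t c), ψ x)
      (∑ k, (1 / ‖l (Sum.inl k)‖ *
        ∫ x in {x ∈ halfplanes l (Sum.elim t c) | inner ℝ (l (Sum.inl k)) x = t k}, ψ x
          ∂Measure.hausdorffMeasure 1) •
        ContinuousLinearMap.proj (R := ℝ) (φ := fun _ : T => ℝ) k) t := by
  classical
  cases nonempty_fintype κ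
  choose b hb using fun k : T => exists_orthonormalBasis_first (hl (Sum.inl k))
  -- The partial derivatives must exist near `t`, so noncoincidence has to be open. It is, because
  -- for each `m` there is at most one possible factor `r`.
  have hopen : ∀ k : T, ∀ᶠ t' in 𝓝 t, ∀ m ≠ Sum.inl k, ∀ r : ℝ, l m = r • l (Sum.inl k) →
      r * t' k ≠ (Sum.elim t' c m : ℝ) := by
    intro k
    refine eventually_all.2 fun m => ?_
    by_cases hm : m ≠ Sum.inl k ∧ ∃ r : ℝ, l m = r • l (Sum.inl k)
    · obtain ⟨hmk, r, hr⟩ := hm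
      have h0 := hne k m hmk r hr
      have hc : Continuous fun t' : T → ℝ => r * t' k - (Sum.elim t' c m : ℝ) := by
        cases m <;> simp only [Sum.elim_inl, Sum.elim_inr] <;> fun_prop
      filter_upwards [hc.continuousAt.eventually (isOpen_ne.mem_nhds (sub_ne_zero.2 h0))]
        with t' ht' _ r' hr'
      have : r' = r := by
        have h := hr'.symm.trans hr
        exact smul_left_injective ℝ (hl (Sum.inl k)) h
      rw [this]
      exact sub_ne_zero.1 ht'
    · exact Eventually.of_forall fun t' hmk r hr => absurd ⟨hmk, r, hr⟩ hm
  have h := hasFDerivAt_of_partials (t₀ := t)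
    (f := fun t : T → ℝ => ∫ x in halfplanes l (Sum.elim t c), ψ x)
    (p := fun k t => 1 / ‖l (Sum.inl k)‖ *
      sliceIntegral ψ (b k) l (Sum.inl k) (t k / ‖l (Sum.inl k)‖) (Sum.elim t c))
    (fun k => (hopen k).mono fun t' ht' => ?_) (fun k => ?_)
  · convert h using 3 with k
    exact congrArg _
      (sliceIntegral_eq_hausdorff (hl (Sum.inl k)) (hb k) (t := Sum.elim t c)).symm
  · have := hasDerivAt_integral_halfplanes hψ hcs (hl (Sum.inl k)) (hb k) (t := Sum.elim t' c) ht'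
    simp only [Sum.update_elim_inl, Sum.elim_inl] at this
    exact this
  · refine ContinuousAt.mul continuousAt_const ?_
    refine (continuousAt_sliceIntegral hψ hcs (hl (Sum.inl k)) (hb k) (t := Sum.elim t c)
      (hne k)).comp_of_eq (f := fun t : T → ℝ => (t k / ‖l (Sum.inl k)‖, Sum.elim t c)) ?_ rfl
    refine ContinuousAt.prodMk ((continuous_apply k).div_const _).continuousAt
      (continuousAt_pi.2 ?_)
    rintro (m | m)
    exacts [(continuous_apply m).continuousAt, continuousAt_const]

end Slices

/-! ### Extension of the density to the plane. -/

section Polygon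

variable {D : Set Plane}

theorem IsConvexPolygon.convex (hD : IsConvexPolygon D) : Convex ℝ D := by
  obtain ⟨⟨S, rfl⟩, -⟩ := hD
  exact convex_convexHull ℝ _

theorem IsConvexPolygon.isCompact (hD : IsConvexPolygon D) : IsCompact D := by
  obtain ⟨⟨S, rfl⟩, -⟩ := hD
  exact S.finite_toSet.isCompact_convexHull ℝ

/-- Tietze extension times a cutoff. With a globally continuous integrand, `D` enters only through
its half-planes, which become constraints with fixed offsets. -/
theorem exists_compactlySupported_extension (hD : IsCompact D) {ρ : Plane → ℝ}
    (hρ : ContinuousOn ρ D) :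
    ∃ ψ : Plane → ℝ, Continuous ψ ∧ HasCompactSupport ψ ∧ EqOn ψ ρ D := by
  obtain ⟨f, hf⟩ := ContinuousMap.exists_restrict_eq hD.isClosed ⟨D.domRestrict ρ, hρ.domRestrict⟩
  obtain ⟨χ, hχ1, -, hχc, -⟩ := exists_continuous_one_zero_of_isCompact hD isClosed_empty
    (disjoint_empty D)
  refine ⟨fun x => χ x * f x, χ.continuous.mul f.continuous, hχc.mul_right, fun x hx => ?_⟩
  have h1 : f x = ρ x := congrArg (fun h : C(D, ℝ) => h ⟨x, hx⟩) hf
  simp [h1, hχ1 hx]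

end Polygon

variable {n : ℕ} {D : Set Plane} {ρ ψ : Plane → ℝ} {a : Fin n → Plane} {ξ : Vec n} {i k : Fin n}

/-! ### Masses of the regions as integrals over polygons. -/

section Mass

theorem densityMeasure_apply_of_subset (hρ0 : ∀ x ∈ D, 0 ≤ ρ x) (hψ : Continuous ψ)
    (hcs : HasCompactSupport ψ) (hψρ : EqOn ψ ρ D) {A : Set Plane} (hA : MeasurableSet A)
    (hAD : A ⊆ D) : densityMeasure D ρ A = ENNReal.ofReal (∫ x in A, ψ x) := by
  rw [densityMeasure, withDensity_apply _ hA, Measure.restrict_restrict hA, inter_eq_left.2 hAD,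
    ofReal_integral_eq_lintegral_ofReal
      (hψ.integrable_of_hasCompactSupport hcs).integrableOn]
  · exact setLIntegral_congr_fun hA fun x hx => by rw [hψρ (hAD hx)]
  · refine (ae_restrict_mem hA).mono fun x hx => ?_
    rw [hψρ (hAD hx)]
    exact hρ0 x (hAD hx)

theorem densityMeasure_real_of_subset (hρ0 : ∀ x ∈ D, 0 ≤ ρ x) (hψ : Continuous ψ)
    (hcs : HasCompactSupport ψ) (hψρ : EqOn ψ ρ D) {A : Set Plane} (hA : MeasurableSet A)
    (hAD : A ⊆ D) : (densityMeasure D ρ).real A = ∫ x in A, ψ x := by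
  rw [Measure.real, densityMeasure_apply_of_subset hρ0 hψ hcs hψρ hA hAD,
    ENNReal.toReal_ofReal]
  refine setIntegral_nonneg hA fun x hx => ?_
  rw [hψρ (hAD hx)]
  exact hρ0 x (hAD hx)

theorem isOpen_region : IsOpen (region D a ξ i) := by
  have : region D a ξ i = interior D ∩
      ⋂ j, ⋂ (_ : j ≠ i), {x | inner ℝ (a j) x - ξ j < inner ℝ (a i) x - ξ i} := by
    refine Set.ext fun x => ?_
    simp [region]
  rw [this]
  exact isOpen_interior.inter (isOpen_iInter_of_finite fun j => isOpen_iInter_of_finite fun _ =>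
    isOpen_lt (by fun_prop) (by fun_prop))

theorem region_subset : region D a ξ i ⊆ D := fun _ hx => interior_subset hx.1

/-- The closed dominating region of `i` among the indices with the property `p`. -/
def cell (D : Set Plane) (a : Fin n → Plane) (p : Fin n → Prop) (ξ : Vec n) (i : Fin n) :
    Set Plane :=
  {x ∈ D | ∀ j, p j → inner ℝ (a j) x - ξ j ≤ inner ℝ (a i) x - ξ i}

/-- Removing the trivial constraint `j = i` keeps the normals `a j - a i` nonzero when `a` is
injective. -/
theorem cell_eq_halfplanes {κ : Type*} {b : κ → Plane} {c : κ → ℝ}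
    (hD : D = {x | ∀ m, inner ℝ (b m) x ≤ c m}) (p : Fin n → Prop) :
    cell D a p ξ i = halfplanes (Sum.elim (fun j : {j // j ≠ i ∧ p j} => a j - a i) b)
      (Sum.elim (fun j : {j // j ≠ i ∧ p j} => ξ j - ξ i) c) := by
  refine Set.ext fun x => ?_
  have h : ∀ j, inner ℝ (a j - a i) x ≤ ξ j - ξ i ↔
      inner ℝ (a j) x - ξ j ≤ inner ℝ (a i) x - ξ i := fun j => by
    rw [inner_sub_left]
    constructor <;> intro h <;> linarith
  simp only [cell, halfplanes, hD, mem_ofPred_eq, Sum.forall, Sum.elim_inl, Sum.elim_inr,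
    Subtype.forall, h]
  constructor
  · exact fun hx => ⟨fun j hj => hx.2 j hj.2, hx.1⟩
  · refine fun hx => ⟨hx.2, fun j hj => ?_⟩
    by_cases hji : j = i
    · rw [hji]
    · exact hx.1 j ⟨hji, hj⟩

theorem isClosed_cell (hD : IsClosed D) (p : Fin n → Prop) : IsClosed (cell D a p ξ i) := by
  have : cell D a p ξ i = D ∩
      ⋂ j, ⋂ (_ : p j), {x | inner ℝ (a j) x - ξ j ≤ inner ℝ (a i) x - ξ i} := by
    refine Set.ext fun x => ?_
    simp [cell]
  rw [this]
  exact hD.inter (isClosed_iInter fun j => isClosed_iInter fun _ =>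
    isClosed_le (by fun_prop) (by fun_prop))

theorem region_subset_cell (p : Fin n → Prop) : region D a ξ i ⊆ cell D a p ξ i := fun x hx =>
  ⟨region_subset hx, fun j _ => by
    by_cases hji : j = i
    · rw [hji]
    · exact (hx.2 j hji).le⟩

theorem ae_scores_ne (ha : Function.Injective a) (ξ : Vec n) :
    ∀ᵐ x : Plane, ∀ j k, j ≠ k → inner ℝ (a j) x - ξ j ≠ inner ℝ (a k) x - ξ k := by
  refine ae_all_iff.2 fun j => ae_all_iff.2 fun k => ?_
  by_cases hjk : j = k
  · exact Eventually.of_forall fun x h => absurd hjk h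
  · filter_upwards [ae_inner_ne (sub_ne_zero.2 (ha.ne hjk)) (ξ j - ξ k)] with x hx _ heq
    refine hx ?_
    rw [inner_sub_left]
    linarith

/-- The two sets differ only on the boundary of the convex set `D` and on finitely many lines of
equal scores. -/
theorem region_ae_eq_cell (ha : Function.Injective a) (hD : Convex ℝ D) (ξ : Vec n) (i : Fin n) :
    region D a ξ i =ᵐ[volume] cell D a (fun _ => True) ξ i := by
  have hfr : ∀ᵐ x : Plane, x ∉ frontier D := measure_eq_zero_iff_ae_notMem.1 (hD.addHaar_frontier _)
  refine eventuallyEq_set.2 ?_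
  filter_upwards [hfr, ae_scores_ne ha ξ] with x hx1 hx2
  refine ⟨fun h => region_subset_cell _ h, fun h => ⟨?_, fun j hj => ?_⟩⟩
  · by_contra h_int
    exact hx1 ⟨subset_closure h.1, h_int⟩
  · exact (h.2 j trivial).lt_of_ne (hx2 j i hj)

theorem massVec_apply_eq_integral (ha : Function.Injective a) (hD : Convex ℝ D)
    (hρ0 : ∀ x ∈ D, 0 ≤ ρ x) (hψ : Continuous ψ) (hcs : HasCompactSupport ψ) (hψρ : EqOn ψ ρ D)
    (ξ : Vec n) (i : Fin n) :
    massVec D ρ a ξ i = ∫ x in cell D a (fun _ => True) ξ i, ψ x := by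
  rw [← setIntegral_congr_set (region_ae_eq_cell ha hD ξ i)]
  exact densityMeasure_real_of_subset hρ0 hψ hcs hψρ isOpen_region.measurableSet region_subset

theorem continuous_massVec (ha : Function.Injective a) (hD : IsConvexPolygon D)
    (hρ : ContinuousOn ρ D) (hρ0 : ∀ x ∈ D, 0 ≤ ρ x) : Continuous (massVec D ρ a) := by
  obtain ⟨ψ, hψ, hcs, hψρ⟩ := exists_compactlySupported_extension hD.isCompact hρ
  obtain ⟨κ, _, b, c, hb, hDb⟩ := hD.exists_halfplanes
  refine (PiLp.continuous_toLp 2 _).comp (continuous_pi fun i => ?_)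
  have h : (fun ξ => (densityMeasure D ρ).real (region D a ξ i)) = fun ξ =>
      ∫ x in cell D a (fun _ => True) ξ i, ψ x := by
    funext ξ
    exact massVec_apply_eq_integral ha hD.convex hρ0 hψ hcs hψρ ξ i
  rw [h]
  simp_rw [fun ξ => cell_eq_halfplanes (a := a) (ξ := ξ) (i := i) hDb fun _ => True]
  refine (continuous_integral_halfplanes hψ hcs ?_).comp (continuous_pi ?_)
  · rintro (⟨j, hj, -⟩ | m)
    exacts [sub_ne_zero.2 (ha.ne hj), hb m]
  · rintro (⟨j, hj, -⟩ | m) <;> simp only [Sum.elim_inl, Sum.elim_inr] <;> fun_prop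

theorem isPC1_massVec (ha : Function.Injective a) (hD : IsConvexPolygon D)
    (hρ : ContinuousOn ρ D) (hρ0 : ∀ x ∈ D, 0 ≤ ρ x) : IsPC1 (massVec D ρ a) := by
  refine IsC1Selection.isPC1 ?_ (continuous_massVec ha hD hρ hρ0)
  obtain ⟨ψ, hψ, hcs, hψρ⟩ := exists_compactlySupported_extension hD.isCompact hρ
  obtain ⟨κ, _, b, c, hb, hDb⟩ := hD.exists_halfplanes
  refine IsC1Selection.toLp fun i => ?_
  have h : (fun ξ => (densityMeasure D ρ).real (region D a ξ i)) = fun ξ =>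
      ∫ x in cell D a (fun _ => True) ξ i, ψ x := by
    funext ξ
    exact massVec_apply_eq_integral ha hD.convex hρ0 hψ hcs hψρ ξ i
  rw [h]
  classical
  simp_rw [fun ξ => cell_eq_halfplanes (a := a) (ξ := ξ) (i := i) hDb fun _ => True]
  have hsum : ∀ ξ : Vec n,
      Sum.elim (fun j : {j // j ≠ i ∧ True} => ξ j - ξ i) c = fun m =>
        (Sum.elim (fun (j : {j // j ≠ i ∧ True}) (ξ : Vec n) => ξ j - ξ i) (fun m _ => c m) m ξ :
          ℝ) := by
    intro ξ
    funext m
    cases m <;> rfl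
  simp_rw [hsum]
  refine isC1Selection_halfplanes _ ?_ hψ hcs
  rintro (⟨j, hj, -⟩ | m)
  · simp only [Sum.elim_inl]
    fun_prop
  · exact contDiff_const

end Mass

/-! ### Empty regions, perturbation, and noncoincident lines. -/

section Geometry

/-- Every score is dominated on `D` by the score of a nonempty region. -/
theorem exists_nonempty_region_ge (ha : Function.Injective a) (hD : IsConvexPolygon D)
    {x : Plane} (hx : x ∈ D) (ξ : Vec n) (i : Fin n) :
    ∃ j, (region D a ξ j).Nonempty ∧ inner ℝ (a i) x - ξ i ≤ inner ℝ (a j) x - ξ j := by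
  by_contra! hc
  -- If score `i` beats all nonempty regions at `x`, it does so on the open set `O`, which meets the
  -- interior of `D`. A point there without ties lies in some region, whose score is then beaten by
  -- score `i`: a contradiction.
  set O : Set Plane := ⋂ j, ⋂ (_ : (region D a ξ j).Nonempty),
    {y | inner ℝ (a j) y - ξ j < inner ℝ (a i) y - ξ i} with hO
  have hOo : IsOpen O := isOpen_iInter_of_finite fun j => isOpen_iInter_of_finite fun _ =>
    isOpen_lt (by fun_prop) (by fun_prop)
  have hxO : x ∈ O := by
    simp only [hO, mem_iInter]
    exact hc
  have hxc : x ∈ closure (interior D) := by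
    rw [hD.convex.closure_interior_eq_closure_of_nonempty_interior hD.2]
    exact subset_closure hx
  have hne : (O ∩ interior D).Nonempty := mem_closure_iff.1 hxc O hOo hxO
  obtain ⟨y, hy, hgen⟩ := (Measure.dense_of_ae (ae_scores_ne ha ξ)).inter_open_nonempty _
    (hOo.inter isOpen_interior) hne
  have : Nonempty (Fin n) := ⟨i⟩
  obtain ⟨j, hj⟩ := Finite.exists_max fun j => inner ℝ (a j) y - ξ j
  have hyj : y ∈ region D a ξ j := ⟨hy.2, fun m hm => (hj m).lt_of_ne (hgen m j hm)⟩
  have h := mem_iInter.1 (mem_iInter.1 hy.1 j) ⟨y, hyj⟩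
  exact (not_lt.2 (hj i)) h

/-- The open segment from a point of the region to a point of the cell stays in the region, because
strict and weak inequalities average to strict ones. For an empty region the cell can still contain
points. -/
theorem closure_region (hD : IsConvexPolygon D) (hne : (region D a ξ i).Nonempty) :
    closure (region D a ξ i) = cell D a (fun _ => True) ξ i := by
  refine (closure_minimal (region_subset_cell _)
    (isClosed_cell hD.isCompact.isClosed _)).antisymm fun x hx => ?_
  obtain ⟨y, hy⟩ := hne
  have hsub : openSegment ℝ y x ⊆ region D a ξ i := by
    intro z hz
    refine ⟨hD.convex.openSegment_interior_self_subset_interior hy.1 hx.1 hz, fun j hj => ?_⟩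
    obtain ⟨s, t, hs, ht, hst, rfl⟩ := hz
    have h1 := mul_lt_mul_of_pos_left (hy.2 j hj) hs
    have h2 := mul_le_mul_of_nonneg_left (hx.2 j trivial) ht.le
    simp only [inner_add_right, inner_smul_right]
    have e1 : ξ j = s * ξ j + t * ξ j := by rw [← add_mul, hst, one_mul]
    have e2 : ξ i = s * ξ i + t * ξ i := by rw [← add_mul, hst, one_mul]
    rw [e1, e2]
    linarith
  exact closure_mono hsub (segment_subset_closure_openSegment (right_mem_segment ℝ y x))

theorem cell_nonempty_regions_eq (ha : Function.Injective a) (hD : IsConvexPolygon D) :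
    cell D a (fun j => (region D a ξ j).Nonempty) ξ i = cell D a (fun _ => True) ξ i := by
  refine Set.ext fun x =>
    ⟨fun hx => ⟨hx.1, fun m _ => ?_⟩, fun hx => ⟨hx.1, fun m _ => hx.2 m trivial⟩⟩
  obtain ⟨j, hj, hle⟩ := exists_nonempty_region_ge ha hD hx.1 ξ m
  exact hle.trans (hx.2 j hj)

open Classical in
/-- The perturbation of `ξ` that removes the empty regions strictly. -/
noncomputable def perturb (D : Set Plane) (a : Fin n → Plane) (ξ : Vec n) (τ : ℝ) : Vec n :=
  ξ + τ • WithLp.toLp 2 fun i => if (region D a ξ i).Nonempty then (0 : ℝ) else 1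

theorem perturb_apply_of_nonempty (h : (region D a ξ i).Nonempty) (τ : ℝ) :
    perturb D a ξ τ i = ξ i := by
  simp [perturb, h]

theorem perturb_apply_of_empty (h : ¬ (region D a ξ i).Nonempty) (τ : ℝ) :
    perturb D a ξ τ i = ξ i + τ := by
  simp [perturb, h]

theorem tendsto_perturb (D : Set Plane) (a : Fin n → Plane) (ξ : Vec n) :
    Tendsto (perturb D a ξ) (𝓝 0) (𝓝 ξ) := by
  have : Continuous (perturb D a ξ) := by
    unfold perturb
    fun_prop
  simpa [perturb] using this.tendsto 0

/-- Near a perturbed point, empty regions are strictly dominated. -/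
theorem eventually_dominated (ha : Function.Injective a) (hD : IsConvexPolygon D) (ξ : Vec n)
    {τ : ℝ} (hτ : 0 < τ) :
    ∀ᶠ η in 𝓝 (perturb D a ξ τ), ∀ x ∈ D, ∀ i, ¬ (region D a ξ i).Nonempty →
      ∃ j, (region D a ξ j).Nonempty ∧ inner ℝ (a i) x - η i < inner ℝ (a j) x - η j := by
  -- The perturbation creates a gap `τ`, and each of the two coordinates compared moves by less than
  -- `τ / 2`.
  filter_upwards [Metric.ball_mem_nhds (perturb D a ξ τ) (half_pos hτ)] with η hη x hx i hi
  obtain ⟨j, hj, hle⟩ := exists_nonempty_region_ge ha hD hx ξ i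
  refine ⟨j, hj, ?_⟩
  have hb : ∀ m, |η m - perturb D a ξ τ m| < τ / 2 := fun m => by
    have h := (PiLp.norm_apply_le (η - perturb D a ξ τ) m).trans_lt (mem_ball_iff_norm.1 hη)
    simpa using h
  have h1 := abs_lt.1 (hb i)
  have h2 := abs_lt.1 (hb j)
  rw [perturb_apply_of_empty hi] at h1
  rw [perturb_apply_of_nonempty hj] at h2
  linarith [h1.1, h2.2]

/-- Three lines that separate pairs of nonempty regions do not coincide, nor does such a line
contain an edge of `D`. -/
theorem not_coincident {κ : Type*} {b : κ → Plane} {c : κ → ℝ}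
    (hb : ∀ m, b m ≠ 0) (hD : D = {x | ∀ m, inner ℝ (b m) x ≤ c m})
    (hi : (region D a ξ i).Nonempty)
    (k : {j // j ≠ i ∧ (region D a ξ j).Nonempty})
    (m : {j // j ≠ i ∧ (region D a ξ j).Nonempty} ⊕ κ) (hm : m ≠ Sum.inl k) (r : ℝ)
    (hr : Sum.elim (fun j : {j // j ≠ i ∧ (region D a ξ j).Nonempty} => a j - a i) b m =
      r • (a k - a i)) :
    r * (ξ k - ξ i) ≠
      (Sum.elim (fun j : {j // j ≠ i ∧ (region D a ξ j).Nonempty} => ξ j - ξ i) c m : ℝ) := by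
  intro heq
  obtain ⟨k, hki, z, hz⟩ := k
  obtain ⟨y, hy⟩ := hi
  have hy1 := hy.2 k hki
  have hz1 := hz.2 i (Ne.symm hki)
  rcases m with ⟨j, hji, w, hw⟩ | m
  · simp only [Sum.elim_inl] at hr heq
    have hjk : j ≠ k := fun h => hm (by subst h; rfl)
    -- If the lines coincide, the score differences of `j` and `k` against `i` are proportional with
    -- factor `r`. The points `y`, `z`, `w` of the regions `i`, `k`, `j` force `r > 0`, `r < 1` and
    -- `r > 1` respectively.
    have hrel : ∀ x, (inner ℝ (a j) x - ξ j) - (inner ℝ (a i) x - ξ i) =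
        r * ((inner ℝ (a k) x - ξ k) - (inner ℝ (a i) x - ξ i)) := fun x => by
      have h := congrArg (fun v => inner ℝ v x) hr
      simp only [inner_sub_left, real_inner_smul_left] at h
      linarith
    have hy2 := hy.2 j hji
    have hz2 := hz.2 j hjk
    have hw1 := hw.2 i hji.symm
    have hw2 := hw.2 k hjk.symm
    have ey := hrel y
    have ez := hrel z
    have ew := hrel w
    have hr0 : 0 < r := by
      by_contra! hr0
      nlinarith
    have hr1 : r < 1 := by
      by_contra! hr1
      nlinarith
    nlinarith
  · simp only [Sum.elim_inr] at hr heq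
    have hyD : inner ℝ (b m) y ≤ c m := by
      have := region_subset hy
      rw [hD] at this
      exact this m
    have hzD : inner ℝ (b m) z ≤ c m := by
      have := region_subset hz
      rw [hD] at this
      exact this m
    rw [hr, real_inner_smul_left, inner_sub_left, ← heq] at hyD hzD
    have hr0 : r ≠ 0 := by
      rintro rfl
      exact hb m (by simpa using hr)
    -- The points `y` and `z` lie strictly on opposite sides of the line, so one of them would be
    -- outside `D`; the sign of `r` decides which.
    rcases lt_or_gt_of_ne hr0 with h | h
    · have := mul_lt_mul_of_neg_left
        (show inner ℝ (a k) y - inner ℝ (a i) y < ξ k - ξ i by linarith) h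
      linarith
    · have := mul_lt_mul_of_pos_left
        (show ξ k - ξ i < inner ℝ (a k) z - inner ℝ (a i) z by linarith) h
      linarith

end Geometry

/-! ### The edge matrix as the derivative of the mass vector at perturbed points. -/

section EdgeMatrix

theorem commonBoundary_subset (hD : IsConvexPolygon D) : commonBoundary D a ξ i k ⊆ D := fun _ hx =>
  closure_minimal region_subset hD.isCompact.isClosed hx.1

theorem edgeWeight_eq_zero_of_empty_left (h : ¬ (region D a ξ i).Nonempty) :
    edgeWeight D ρ a ξ i k = 0 := by
  simp [edgeWeight, commonBoundary, not_nonempty_iff_eq_empty.1 h]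

theorem edgeWeight_eq_zero_of_empty_right (h : ¬ (region D a ξ k).Nonempty) :
    edgeWeight D ρ a ξ i k = 0 := by
  simp [edgeWeight, commonBoundary, not_nonempty_iff_eq_empty.1 h]

theorem edgeWeight_eq_zero_of_not_shareEdge (hik : i ≠ k) (h : ¬ ShareEdge D a ξ i k) :
    edgeWeight D ρ a ξ i k = 0 := by
  have hs : (commonBoundary D a ξ i k).Subsingleton :=
    not_nontrivial_iff.1 fun hn => h ⟨hik, hn⟩
  have : NullSingletonClass (Measure.hausdorffMeasure 1 : Measure Plane) :=
    Measure.nullSingletonClass_hausdorff _ one_pos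
  rw [edgeWeight, setIntegral_measure_zero _ (hs.measure_zero _), mul_zero]

/-- A nonnegative continuous density with zero integral over an open region vanishes on its closure,
hence on its edges. So the zero rows prescribed in `edgeMatrix` agree with the general formula. -/
theorem edgeWeight_eq_zero_of_massless (hD : IsConvexPolygon D) (hρ : ContinuousOn ρ D)
    (hρ0 : ∀ x ∈ D, 0 ≤ ρ x) (h : ¬ 0 < densityMeasure D ρ (region D a ξ i)) :
    edgeWeight D ρ a ξ i k = 0 := by
  obtain ⟨ψ, hψ, hcs, hψρ⟩ := exists_compactlySupported_extension hD.isCompact hρ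
  have h0 : ∫ x in region D a ξ i, ψ x = 0 := by
    rw [← densityMeasure_real_of_subset hρ0 hψ hcs hψρ isOpen_region.measurableSet region_subset,
      Measure.real, nonpos_iff_eq_zero.1 (not_lt.1 h), ENNReal.toReal_zero]
  have hnn : ∀ x ∈ region D a ξ i, 0 ≤ ψ x := fun x hx => by
    rw [hψρ (region_subset hx)]; exact hρ0 x (region_subset hx)
  have hzero : EqOn ψ 0 (region D a ξ i) := by
    have hae := (setIntegral_eq_zero_iff_of_nonneg_ae
      ((ae_restrict_mem isOpen_region.measurableSet).mono hnn)
      (hψ.integrable_of_hasCompactSupport hcs).integrableOn).1 h0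
    exact Measure.eqOn_open_of_ae_eq hae isOpen_region hψ.continuousOn continuousOn_const
  have hcl : EqOn ψ 0 (closure (region D a ξ i)) := hzero.closure hψ continuous_const
  have h_int : ∫ x in commonBoundary D a ξ i k, ρ x ∂Measure.hausdorffMeasure 1 = 0 := by
    refine setIntegral_eq_zero_of_forall_eq_zero fun x hx => ?_
    rw [← hψρ (commonBoundary_subset hD hx)]
    exact hcl hx.1
  rw [edgeWeight, h_int, mul_zero]

/-- All case distinctions in `edgeMatrix` only discard weights that vanish anyway, and the diagonal
entry turns `v k` into `v k - v i`. -/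
theorem edgeMap_apply (hD : IsConvexPolygon D) (hρ : ContinuousOn ρ D)
    (hρ0 : ∀ x ∈ D, 0 ≤ ρ x) (v : Vec n) :
    edgeMap D ρ a ξ v i = ∑ k with k ≠ i, edgeWeight D ρ a ξ i k * (v k - v i) := by
  classical
  have hoff : ∀ k, k ≠ i → edgeMatrix D ρ a ξ i k = edgeWeight D ρ a ξ i k := by
    intro k hk
    simp only [edgeMatrix, Matrix.of_apply, if_neg hk]
    split_ifs with h1 h2
    · rfl
    · exact (edgeWeight_eq_zero_of_not_shareEdge hk.symm h2).symm
    · exact (edgeWeight_eq_zero_of_massless hD hρ hρ0 h1).symm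
  have hdiag : edgeMatrix D ρ a ξ i i = -∑ k with k ≠ i, edgeWeight D ρ a ξ i k := by
    simp only [edgeMatrix, Matrix.of_apply, if_true]
    split_ifs with h1
    · congr 1
      refine Finset.sum_subset (fun k hk => ?_) fun k hk hk' => ?_
      · simp only [Finset.mem_filter, Finset.mem_univ, true_and] at hk ⊢
        exact hk.1.symm
      · simp only [Finset.mem_filter, Finset.mem_univ, true_and] at hk hk'
        exact edgeWeight_eq_zero_of_not_shareEdge hk.symm hk'
    · rw [Finset.sum_eq_zero fun k _ => edgeWeight_eq_zero_of_massless hD hρ hρ0 h1, neg_zero]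
  have happ : edgeMap D ρ a ξ v i = ∑ k, edgeMatrix D ρ a ξ i k * v k := by
    rw [edgeMap, Matrix.ofLp_toEuclideanCLM]
    rfl
  rw [happ, ← Finset.sum_filter_add_sum_filter_not Finset.univ (fun k => k ≠ i)]
  have h1 : ∑ k with ¬ k ≠ i, edgeMatrix D ρ a ξ i k * v k =
      ∑ k with k ≠ i, edgeWeight D ρ a ξ i k * -v i := by
    have : (Finset.univ.filter fun k => ¬ k ≠ i) = {i} := by ext; simp
    rw [this, Finset.sum_singleton, hdiag, ← Finset.sum_mul]
    ring
  rw [h1, ← Finset.sum_add_distrib]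
  refine Finset.sum_congr rfl fun k hk => ?_
  rw [hoff k (Finset.mem_filter.1 hk).2]
  ring

/-- The perturbation does not touch nonempty indices, and constraints from empty regions are
redundant at `ξ`. So the edges at the perturbed point are those of `ξ`. -/
theorem edgeWeight_eq_of_nonempty (ha : Function.Injective a) (hD : IsConvexPolygon D)
    (hψρ : EqOn ψ ρ D) (hi : (region D a ξ i).Nonempty) (hk : (region D a ξ k).Nonempty) (τ : ℝ) :
    edgeWeight D ρ a ξ i k = 1 / ‖a k - a i‖ *
      ∫ x in {x ∈ cell D a (fun j => (region D a ξ j).Nonempty) (perturb D a ξ τ) i |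
        inner ℝ (a k - a i) x = perturb D a ξ τ k - perturb D a ξ τ i}, ψ x
          ∂Measure.hausdorffMeasure 1 := by
  have hcell : cell D a (fun j => (region D a ξ j).Nonempty) (perturb D a ξ τ) i =
      cell D a (fun _ => True) ξ i := by
    rw [← cell_nonempty_regions_eq ha hD]
    refine Set.ext fun x => and_congr_right fun _ => forall_congr' fun j =>
      imp_congr_right fun hj => ?_
    rw [perturb_apply_of_nonempty hj, perturb_apply_of_nonempty hi]
  have hset : {x ∈ cell D a (fun j => (region D a ξ j).Nonempty) (perturb D a ξ τ) i |
      inner ℝ (a k - a i) x = perturb D a ξ τ k - perturb D a ξ τ i} =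
      commonBoundary D a ξ i k := by
    rw [hcell, commonBoundary, closure_region hD hi, closure_region hD hk,
      perturb_apply_of_nonempty hi, perturb_apply_of_nonempty hk]
    refine Set.ext fun x => ⟨fun hx => ⟨hx.1, hx.1.1, fun j _ => ?_⟩, fun hx => ⟨hx.1, ?_⟩⟩
    · have h1 := hx.1.2 j trivial
      have h2 := hx.2
      rw [inner_sub_left] at h2
      linarith
    · have h1 := hx.1.2 k trivial
      have h2 := hx.2.2 i trivial
      rw [inner_sub_left]
      linarith
  rw [hset, edgeWeight]
  congr 1
  refine setIntegral_congr_fun ?_ fun x hx => (hψρ (commonBoundary_subset hD hx)).symm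
  exact (isClosed_closure.inter isClosed_closure).measurableSet

end EdgeMatrix

/-- The mass vector is differentiable at the perturbed points, with the edge matrix of `ξ` as
derivative. -/
theorem hasFDerivAt_massVec_perturb (ha : Function.Injective a) (hD : IsConvexPolygon D)
    (hρ : ContinuousOn ρ D) (hρ0 : ∀ x ∈ D, 0 ≤ ρ x) (ξ : Vec n) {τ : ℝ} (hτ : 0 < τ) :
    HasFDerivAt (massVec D ρ a) (edgeMap D ρ a ξ) (perturb D a ξ τ) := by
  classical
  obtain ⟨ψ, hψ, hcs, hψρ⟩ := exists_compactlySupported_extension hD.isCompact hρ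
  obtain ⟨κ, _, b, c, hb, hDb⟩ := hD.exists_halfplanes
  rw [← hasFDerivWithinAt_univ, hasFDerivWithinAt_euclidean]
  intro i
  rw [hasFDerivWithinAt_univ]
  have hdom := eventually_dominated ha hD ξ hτ
  by_cases hi : (region D a ξ i).Nonempty
  · let T := {j // j ≠ i ∧ (region D a ξ j).Nonempty}
    let l : T ⊕ κ → Plane := Sum.elim (fun j : T => a j - a i) b
    let L : Vec n →L[ℝ] (T → ℝ) := ContinuousLinearMap.pi fun j : T =>
      EuclideanSpace.proj (j : Fin n) - EuclideanSpace.proj i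
    have hL : ∀ η : Vec n, L η = fun j : T => η j - η i := fun η => rfl
    have hl : ∀ m, l m ≠ 0 := by
      rintro (⟨j, hj, -⟩ | m)
      exacts [sub_ne_zero.2 (ha.ne hj), hb m]
    have hLp : L (perturb D a ξ τ) = fun j : T => ξ j - ξ i := by
      rw [hL]
      funext j
      rw [perturb_apply_of_nonempty hi, perturb_apply_of_nonempty j.2.2]
    have hder := hasFDerivAt_integral_halfplanes hψ hcs hl (c := c) (t := L (perturb D a ξ τ))
      (fun k m hm r hr => by
        rw [hLp]
        exact not_coincident hb hDb hi k m hm r hr)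
    have hcomp := hder.comp (perturb D a ξ τ) L.hasFDerivAt
    -- Near the perturbed point the constraints of empty regions are implied by the others, so the
    -- mass depends only on the differences collected in `L`.
    have heq : (fun η => massVec D ρ a η i) =ᶠ[𝓝 (perturb D a ξ τ)]
        (fun t : T → ℝ => ∫ x in halfplanes l (Sum.elim t c), ψ x) ∘ L := by
      filter_upwards [hdom] with η hη
      rw [massVec_apply_eq_integral ha hD.convex hρ0 hψ hcs hψρ]
      have hc : cell D a (fun _ => True) η i =
          cell D a (fun j => (region D a ξ j).Nonempty) η i := by
        refine Set.ext fun x =>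
          ⟨fun hx => ⟨hx.1, fun m _ => hx.2 m trivial⟩, fun hx => ⟨hx.1, fun m _ => ?_⟩⟩
        by_cases hm : (region D a ξ m).Nonempty
        · exact hx.2 m hm
        · obtain ⟨j, hj, hlt⟩ := hη x hx.1 m hm
          exact hlt.le.trans (hx.2 j hj)
      rw [hc, cell_eq_halfplanes hDb]
      rfl
    refine (hcomp.congr_of_eventuallyEq heq).congr_fderiv ?_
    ext v
    have hedge := edgeMap_apply (a := a) (ξ := ξ) (i := i) hD hρ hρ0 v
    have hface : ∀ k : T, {x ∈ halfplanes l (Sum.elim (L (perturb D a ξ τ)) c) |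
        inner ℝ (l (Sum.inl k)) x = L (perturb D a ξ τ) k} =
        {x ∈ cell D a (fun j => (region D a ξ j).Nonempty) (perturb D a ξ τ) i |
          inner ℝ (a k - a i) x = perturb D a ξ τ k - perturb D a ξ τ i} := fun k => by
      rw [cell_eq_halfplanes hDb]
      rfl
    have hw : ∀ k : T, 1 / ‖l (Sum.inl k)‖ *
        ∫ x in {x ∈ halfplanes l (Sum.elim (L (perturb D a ξ τ)) c) |
          inner ℝ (l (Sum.inl k)) x = L (perturb D a ξ τ) k}, ψ x ∂Measure.hausdorffMeasure 1 =
        edgeWeight D ρ a ξ i k := fun k => by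
      rw [hface, edgeWeight_eq_of_nonempty ha hD hψρ hi k.2.2 τ]
      rfl
    simp_rw [hw]
    have hsum : ∑ k with k ≠ i, edgeWeight D ρ a ξ i k * (v k - v i) =
        ∑ k : T, edgeWeight D ρ a ξ i k * (v k - v i) := by
      rw [← Finset.sum_subtype (Finset.univ.filter fun j => j ≠ i ∧ (region D a ξ j).Nonempty)
        (by simp) fun k => edgeWeight D ρ a ξ i k * (v k - v i)]
      refine (Finset.sum_subset (fun k hk => ?_) fun k hk hk' => ?_).symm
      · simp only [Finset.mem_filter, Finset.mem_univ, true_and] at hk ⊢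
        exact hk.1
      · simp only [Finset.mem_filter, Finset.mem_univ, true_and] at hk hk'
        rw [edgeWeight_eq_zero_of_empty_right fun h => hk' ⟨hk, h⟩, zero_mul]
    simp only [ContinuousLinearMap.comp_apply, PiLp.proj_apply]
    rw [hedge, hsum]
    simp [hL]
  -- A strictly dominated region stays empty, matching the zero row of the edge matrix.
  · have heq : (fun η => massVec D ρ a η i) =ᶠ[𝓝 (perturb D a ξ τ)] fun _ => (0 : ℝ) := by
      filter_upwards [hdom] with η hη
      have hempty : region D a η i = ∅ := by
        refine eq_empty_of_forall_notMem fun x hx => ?_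
        obtain ⟨j, hj, hlt⟩ := hη x (region_subset hx) i hi
        have hji : j ≠ i := fun h => hi (h ▸ hj)
        exact lt_asymm hlt (hx.2 j hji)
      simp [massVec, hempty]
    refine ((hasFDerivAt_const (0 : ℝ) (perturb D a ξ τ)).congr_of_eventuallyEq heq).congr_fderiv ?_
    ext v
    simp only [ContinuousLinearMap.comp_apply, PiLp.proj_apply]
    rw [edgeMap_apply (a := a) (ξ := ξ) (i := i) hD hρ hρ0 v]
    simp [edgeWeight_eq_zero_of_empty_left hi]

/-! ### Integration against the source measure. -/

section DensityMeasure

theorem isFiniteMeasure_densityMeasure (hD : IsCompact D) (hρ : ContinuousOn ρ D) :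
    IsFiniteMeasure (densityMeasure D ρ) :=
  isFiniteMeasure_withDensity_ofReal (hρ.integrableOn_compact hD).2

theorem ae_densityMeasure {p : Plane → Prop} (h : ∀ᵐ x ∂(volume.restrict D), p x) :
    ∀ᵐ x ∂densityMeasure D ρ, p x :=
  (withDensity_absolutelyContinuous _ _).ae_le h

theorem integrable_densityMeasure (hD : IsCompact D) (hρ : ContinuousOn ρ D) {f : Plane → ℝ}
    (hf : Continuous f) : Integrable f (densityMeasure D ρ) := by
  have := isFiniteMeasure_densityMeasure hD hρ
  obtain ⟨C, hC⟩ := hD.exists_bound_of_continuousOn hf.continuousOn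
  exact Integrable.of_bound hf.aestronglyMeasurable C
    (ae_densityMeasure ((ae_restrict_mem hD.isClosed.measurableSet).mono hC))

theorem ae_mem_region [Nonempty (Fin n)] (ha : Function.Injective a) (hD : IsConvexPolygon D)
    (ξ : Vec n) : ∀ᵐ x ∂densityMeasure D ρ, ∃ i, x ∈ region D a ξ i := by
  refine ae_densityMeasure ?_
  have hfr : ∀ᵐ x : Plane, x ∉ frontier D :=
    measure_eq_zero_iff_ae_notMem.1 (hD.convex.addHaar_frontier _)
  filter_upwards [ae_restrict_mem hD.isCompact.isClosed.measurableSet, ae_restrict_of_ae hfr,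
    ae_restrict_of_ae (ae_scores_ne ha ξ)] with x hx1 hx2 hx3
  obtain ⟨j, hj⟩ := Finite.exists_max fun j => inner ℝ (a j) x - ξ j
  refine ⟨j, ?_, fun m hm => (hj m).lt_of_ne (hx3 m j hm)⟩
  by_contra h_int
  exact hx2 ⟨subset_closure hx1, h_int⟩

theorem region_disjoint {i j : Fin n} (hij : i ≠ j) {x : Plane} (hi : x ∈ region D a ξ i) :
    x ∉ region D a ξ j := fun hj => lt_asymm (hi.2 j hij.symm) (hj.2 i hij)

theorem integral_sum_indicator_region {X : Type*} [NormedAddCommGroup X] [NormedSpace ℝ X]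
    [CompleteSpace X] (hD : IsConvexPolygon D) (hρ : ContinuousOn ρ D) (ξ : Vec n) (p : Fin n → X) :
    ∃ F : Plane → X, Integrable F (densityMeasure D ρ) ∧
      (∀ i, ∀ x ∈ region D a ξ i, F x = p i) ∧
      ∫ x, F x ∂densityMeasure D ρ = ∑ i, massVec D ρ a ξ i • p i := by
  have := isFiniteMeasure_densityMeasure hD.isCompact hρ
  have hi : ∀ i, Integrable (fun x => (region D a ξ i).indicator (fun _ => p i) x)
      (densityMeasure D ρ) := fun i =>
    (integrable_const (p i)).indicator isOpen_region.measurableSet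
  refine ⟨fun x => ∑ i, (region D a ξ i).indicator (fun _ => p i) x,
    integrable_finsetSum _ fun i _ => hi i, fun i x hx => ?_, ?_⟩
  · dsimp only
    rw [Finset.sum_eq_single i]
    · exact indicator_of_mem hx _
    · exact fun j _ hj => indicator_of_notMem (region_disjoint hj.symm hx) _
    · exact fun h => absurd (Finset.mem_univ i) h
  · rw [integral_finsetSum _ fun i _ => hi i]
    refine Finset.sum_congr rfl fun i _ => ?_
    rw [integral_indicator_const _ isOpen_region.measurableSet]
    rfl

end DensityMeasure

/-! ### The dual potential and its gradient. -/

section Potential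

variable [Nonempty (Fin n)]

/-- The potential `x ↦ maxᵢ (aᵢᵀ x - ξᵢ)`. -/
noncomputable def potential (a : Fin n → Plane) (ξ : Vec n) (x : Plane) : ℝ :=
  Finset.univ.sup' Finset.univ_nonempty fun i => inner ℝ (a i) x - ξ i

theorem le_potential (i : Fin n) (x : Plane) : inner ℝ (a i) x - ξ i ≤ potential a ξ x :=
  Finset.le_sup' (fun i => inner ℝ (a i) x - ξ i) (Finset.mem_univ i)

theorem potential_eq_of_mem {i : Fin n} {x : Plane} (hx : x ∈ region D a ξ i) :
    potential a ξ x = inner ℝ (a i) x - ξ i := by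
  refine le_antisymm (Finset.sup'_le _ _ fun j _ => ?_) (le_potential i x)
  by_cases hj : j = i
  · rw [hj]
  · exact (hx.2 j hj).le

theorem continuous_potential (ξ : Vec n) : Continuous (potential a ξ) :=
  Continuous.finset_sup'_apply _ fun i _ => by fun_prop

theorem lipschitzWith_potential (x : Plane) : LipschitzWith 1 fun ξ : Vec n => potential a ξ x := by
  refine LipschitzWith.of_le_add fun ξ η => Finset.sup'_le _ _ fun i _ => ?_
  have h1 := le_potential (a := a) (ξ := η) i x
  have h2 := (le_abs_self _).trans (PiLp.norm_apply_le (η - ξ) i)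
  rw [← dist_eq_norm, dist_comm] at h2
  have h3 : (η - ξ) i = η i - ξ i := rfl
  linarith

theorem hasFDerivAt_potential {i : Fin n} {x : Plane} (hx : x ∈ region D a ξ i) :
    HasFDerivAt (fun ξ : Vec n => potential a ξ x)
      (-(EuclideanSpace.proj i : Vec n →L[ℝ] ℝ)) ξ := by
  have h : HasFDerivAt (fun ξ : Vec n => inner ℝ (a i) x - ξ i)
      (-(EuclideanSpace.proj i : Vec n →L[ℝ] ℝ)) ξ :=
    (EuclideanSpace.proj i : Vec n →L[ℝ] ℝ).hasFDerivAt.const_sub _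
  refine h.congr_of_eventuallyEq ?_
  have hev : ∀ᶠ η : Vec n in 𝓝 ξ, ∀ j, j ≠ i → inner ℝ (a j) x - η j < inner ℝ (a i) x - η i :=
    eventually_all.2 fun j => by
      by_cases hj : j = i
      · exact Eventually.of_forall fun _ h => absurd hj h
      · have ho : IsOpen {η : Vec n | inner ℝ (a j) x - η j < inner ℝ (a i) x - η i} :=
          isOpen_lt (by fun_prop) (by fun_prop)
        filter_upwards [ho.mem_nhds (hx.2 j hj)] with η hη _ using hη
  filter_upwards [hev] with η hη
  exact potential_eq_of_mem (D := D) ⟨hx.1, hη⟩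

/-- Differentiation under the integral sign: the potential is 1-Lipschitz in `ξ` for every `x`, and
differentiable at `ξ` for every `x` in a region, hence for almost every `x`. -/
theorem hasFDerivAt_integral_potential_of_eq_on_regions (ha : Function.Injective a) (hD : IsConvexPolygon D)
    (hρ : ContinuousOn ρ D) (ξ : Vec n) {F' : Plane → Vec n →L[ℝ] ℝ}
    (hF'int : Integrable F' (densityMeasure D ρ))
    (hF'eq : ∀ i, ∀ x ∈ region D a ξ i, F' x = -EuclideanSpace.proj i) :
    HasFDerivAt (fun ξ : Vec n => ∫ x, potential a ξ x ∂densityMeasure D ρ)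
      (∫ x, F' x ∂densityMeasure D ρ) ξ := by
  have := isFiniteMeasure_densityMeasure hD.isCompact hρ
  have hlip : ∀ᵐ x ∂densityMeasure D ρ, LipschitzOnWith (Real.nnabs 1)
      (fun ξ : Vec n => potential a ξ x) univ := Eventually.of_forall fun x => by
    have h1 : Real.nnabs 1 = 1 := by simp
    rw [h1]
    exact (lipschitzWith_potential (a := a) x).lipschitzOnWith
  have hdiff : ∀ᵐ x ∂densityMeasure D ρ,
      HasFDerivAt (fun ξ : Vec n => potential a ξ x) (F' x) ξ := by
    filter_upwards [ae_mem_region ha hD ξ] with x hx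
    obtain ⟨i, hi⟩ := hx
    rw [hF'eq i x hi]
    exact hasFDerivAt_potential hi
  have hmeas : ∀ᶠ η : Vec n in 𝓝 ξ, AEStronglyMeasurable (potential a η) (densityMeasure D ρ) :=
    Eventually.of_forall fun η => (continuous_potential η).aestronglyMeasurable
  have hpint := integrable_densityMeasure hD.isCompact hρ (continuous_potential (a := a) ξ)
  exact (hasFDerivAt_integral_of_dominated_loc_of_lip (μ := densityMeasure D ρ)
    (F := fun (ξ : Vec n) x => potential a ξ x) (F' := F') (x₀ := ξ) (s := univ)
    (bound := fun _ => 1) univ_mem hmeas hpint hF'int.aestronglyMeasurable hlip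
    (integrable_const (1 : ℝ)) hdiff).2

/-- The gradient of the integrated potential is the negative mass vector. -/
theorem hasFDerivAt_integral_potential (ha : Function.Injective a) (hD : IsConvexPolygon D)
    (hρ : ContinuousOn ρ D) (ξ : Vec n) :
    HasFDerivAt (fun ξ : Vec n => ∫ x, potential a ξ x ∂densityMeasure D ρ)
      (-row (massVec D ρ a ξ)) ξ := by
  obtain ⟨F', h_int, heq, hval⟩ := integral_sum_indicator_region hD hρ ξ (a := a)
    fun i => -(EuclideanSpace.proj i : Vec n →L[ℝ] ℝ)
  refine (hasFDerivAt_integral_potential_of_eq_on_regions ha hD hρ ξ h_int heq).congr_fderiv ?_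
  rw [hval]
  ext v
  simp [row, PiLp.inner_apply, mul_comm]

end Potential

/-! ### Kantorovich duality and the formula for the transport cost. -/

section Couplings

/-- The dual function on the target side. -/
noncomputable def targetPotential (a : Fin n → Plane) (ξ : Vec n) (y : Plane) : ℝ :=
  ∑ i, ({a i} : Set Plane).indicator (fun _ => ‖a i‖ ^ 2 - 2 * ξ i) y

theorem targetPotential_apply (ha : Function.Injective a) (i : Fin n) :
    targetPotential a ξ (a i) = ‖a i‖ ^ 2 - 2 * ξ i := by
  rw [targetPotential, Finset.sum_eq_single i]
  · simp
  · intro j _ hj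
    simp [ha.ne hj.symm]
  · exact fun h => absurd (Finset.mem_univ i) h

theorem measurable_targetPotential : Measurable (targetPotential a ξ) :=
  Finset.measurable_fun_sum _ fun _ _ => measurable_const.indicator (measurableSet_singleton _)

theorem ae_massMeasure : ∀ᵐ y ∂massMeasure D ρ a ξ, y ∈ range a := by
  rw [massMeasure, ← Measure.sum_fintype, Measure.ae_sum_iff]
  · intro i
    refine Measure.ae_smul_measure ?_ _
    exact (ae_dirac_iff (p := fun y => y ∈ range a) (finite_range a).measurableSet).2
      (mem_range_self i)

variable [Nonempty (Fin n)]

/-- The integrand splits into functions of one variable each, so its integral depends only on the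
marginals and is the same for all couplings. -/
theorem integral_dual_eq (ha : Function.Injective a) (hD : IsConvexPolygon D)
    (hρ : ContinuousOn ρ D) {γ : Measure (Plane × Plane)}
    (hγ : γ ∈ couplings (densityMeasure D ρ) (massMeasure D ρ a ξ)) :
    Integrable (fun z : Plane × Plane =>
      (‖z.1‖ ^ 2 - 2 * potential a ξ z.1) + targetPotential a ξ z.2) γ ∧
    ∫ z, (‖z.1‖ ^ 2 - 2 * potential a ξ z.1) + targetPotential a ξ z.2 ∂γ =
      ∫ x, ‖x‖ ^ 2 ∂densityMeasure D ρ - 2 * ∫ x, potential a ξ x ∂densityMeasure D ρ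
        + 2 * inner ℝ (halfSq a - ξ) (massVec D ρ a ξ) := by
  have hfin := isFiniteMeasure_densityMeasure hD.isCompact hρ
  have hpot := continuous_potential (a := a) ξ
  have hi1 : Integrable (fun x : Plane => ‖x‖ ^ 2) (densityMeasure D ρ) :=
    integrable_densityMeasure hD.isCompact hρ (by fun_prop)
  have hi2 : Integrable (potential a ξ) (densityMeasure D ρ) :=
    integrable_densityMeasure hD.isCompact hρ hpot
  have hu : Integrable (fun x => ‖x‖ ^ 2 - 2 * potential a ξ x) (densityMeasure D ρ) :=
    hi1.sub (hi2.const_mul 2)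
  have hdirac : ∀ i, Integrable (targetPotential a ξ)
      (densityMeasure D ρ (region D a ξ i) • Measure.dirac (a i)) := fun i =>
    (integrable_dirac (by simp)).smul_measure (measure_ne_top _ _)
  have hh : Integrable (targetPotential a ξ) (massMeasure D ρ a ξ) :=
    integrable_finsetSum_measure.2 fun i _ => hdirac i
  have hu' : Integrable (fun z : Plane × Plane => ‖z.1‖ ^ 2 - 2 * potential a ξ z.1) γ := by
    rw [← hγ.1] at hu
    exact hu.comp_measurable measurable_fst
  have hh' : Integrable (fun z : Plane × Plane => targetPotential a ξ z.2) γ := by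
    rw [← hγ.2] at hh
    exact hh.comp_measurable measurable_snd
  refine ⟨hu'.add hh', ?_⟩
  rw [integral_add hu' hh']
  have e1 : ∫ z, (‖z.1‖ ^ 2 - 2 * potential a ξ z.1) ∂γ =
      ∫ x, ‖x‖ ^ 2 ∂densityMeasure D ρ - 2 * ∫ x, potential a ξ x ∂densityMeasure D ρ := by
    rw [← integral_const_mul, ← integral_sub hi1 (hi2.const_mul 2), ← hγ.1,
      integral_map measurable_fst.aemeasurable]
    exact ((by fun_prop : Continuous fun x : Plane => ‖x‖ ^ 2).sub
      (hpot.const_mul 2)).aestronglyMeasurable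
  have e2 : ∫ z, targetPotential a ξ z.2 ∂γ = 2 * inner ℝ (halfSq a - ξ) (massVec D ρ a ξ) := by
    have h1 : ∫ z, targetPotential a ξ z.2 ∂γ =
        ∫ y, targetPotential a ξ y ∂(massMeasure D ρ a ξ) := by
      rw [← hγ.2, integral_map measurable_snd.aemeasurable
        measurable_targetPotential.aestronglyMeasurable]
    rw [h1, massMeasure, integral_finsetSum_measure fun i _ => hdirac i]
    simp_rw [integral_smul_measure, integral_dirac, targetPotential_apply ha]
    rw [PiLp.inner_apply, Finset.mul_sum]
    refine Finset.sum_congr rfl fun i _ => ?_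
    simp [massVec, halfSq, Measure.real]
    ring
  rw [e1, e2]

/-- The coupling that sends each region to its point. -/
noncomputable def regionCoupling (D : Set Plane) (ρ : Plane → ℝ) (a : Fin n → Plane) (ξ : Vec n) :
    Measure (Plane × Plane) :=
  Measure.sum fun i => ((densityMeasure D ρ).restrict (region D a ξ i)).map fun x => (x, a i)

theorem regionCoupling_mem (ha : Function.Injective a) (hD : IsConvexPolygon D) :
    regionCoupling D ρ a ξ ∈ couplings (densityMeasure D ρ) (massMeasure D ρ a ξ) := by
  have hm : ∀ i, Measurable fun x : Plane => (x, a i) := fun i => by fun_prop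
  constructor
  · rw [regionCoupling, Measure.map_sum measurable_fst.aemeasurable]
    simp_rw [fun i => Measure.map_map measurable_fst (hm i)
      (μ := (densityMeasure D ρ).restrict (region D a ξ i))]
    have hid : ∀ i, (Prod.fst ∘ fun x : Plane => (x, a i)) = id := fun i => rfl
    simp_rw [hid, Measure.map_id]
    rw [← Measure.restrict_iUnion (fun i j hij => disjoint_left.2 fun x hx =>
      region_disjoint hij hx) fun i => isOpen_region.measurableSet]
    exact Measure.restrict_eq_self_of_ae_mem
      ((ae_mem_region ha hD ξ).mono fun x hx => mem_iUnion.2 hx)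
  · rw [regionCoupling, Measure.map_sum measurable_snd.aemeasurable, massMeasure,
      ← Measure.sum_fintype]
    congr 1
    funext i
    rw [Measure.map_map measurable_snd (hm i)]
    have hc : (Prod.snd ∘ fun x : Plane => (x, a i)) = fun _ => a i := rfl
    rw [hc, Measure.map_const, Measure.restrict_apply_univ]

/-- The dual integrand is at most the cost wherever the second component is some `a i`, and equals
it where the first lies in region `i`. So its integral bounds every coupling from below, and
`regionCoupling` attains the bound. -/
theorem transportCost_eq (ha : Function.Injective a) (hD : IsConvexPolygon D)
    (hρ : ContinuousOn ρ D) (ξ : Vec n) :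
    transportCost D ρ a ξ =
      ∫ x, ‖x‖ ^ 2 ∂densityMeasure D ρ - 2 * ∫ x, potential a ξ x ∂densityMeasure D ρ
        + 2 * inner ℝ (halfSq a - ξ) (massVec D ρ a ξ) := by
  set w := ∫ x, ‖x‖ ^ 2 ∂densityMeasure D ρ - 2 * ∫ x, potential a ξ x ∂densityMeasure D ρ
        + 2 * inner ℝ (halfSq a - ξ) (massVec D ρ a ξ) with hw
  set g : Plane × Plane → ℝ := fun z =>
    (‖z.1‖ ^ 2 - 2 * potential a ξ z.1) + targetPotential a ξ z.2 with hg
  have hcost : ∀ i x, ‖x - a i‖ ^ 2 =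
      (‖x‖ ^ 2 - 2 * (inner ℝ (a i) x - ξ i)) + targetPotential a ξ (a i) := fun i x => by
    rw [targetPotential_apply ha, norm_sub_sq_real, real_inner_comm]
    ring
  have hlower : ∀ γ ∈ couplings (densityMeasure D ρ) (massMeasure D ρ a ξ),
      ENNReal.ofReal w ≤ ∫⁻ z, ENNReal.ofReal (‖z.1 - z.2‖ ^ 2) ∂γ := by
    intro γ hγ
    obtain ⟨hgi, hgw⟩ := integral_dual_eq ha hD hρ hγ
    have hmem : ∀ᵐ z ∂γ, z.2 ∈ range a := by
      have h := ae_massMeasure (D := D) (ρ := ρ) (a := a) (ξ := ξ)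
      rw [← hγ.2] at h
      exact ae_of_ae_map measurable_snd.aemeasurable h
    have hle : ∀ᵐ z ∂γ, g z ≤ ‖z.1 - z.2‖ ^ 2 := by
      filter_upwards [hmem] with z hz
      obtain ⟨i, hi⟩ := hz
      rw [← hi, hcost, hg]
      dsimp only
      rw [← hi]
      have := le_potential (a := a) (ξ := ξ) i z.1
      linarith
    -- The dual integrand may be negative; its positive part is still below the cost and can be
    -- integrated in `ENNReal`.
    calc ENNReal.ofReal w ≤ ENNReal.ofReal (∫ z, max (g z) 0 ∂γ) := by
          refine ENNReal.ofReal_le_ofReal ?_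
          rw [hw, ← hgw]
          exact integral_mono hgi hgi.pos_part fun z => le_max_left _ _
      _ = ∫⁻ z, ENNReal.ofReal (max (g z) 0) ∂γ :=
          ofReal_integral_eq_lintegral_ofReal hgi.pos_part
            (Eventually.of_forall fun z => le_max_right _ _)
      _ ≤ _ := lintegral_mono_ae (hle.mono fun z hz =>
          ENNReal.ofReal_le_ofReal (max_le hz (sq_nonneg _)))
  have hopt := regionCoupling_mem (ρ := ρ) (ξ := ξ) ha hD
  obtain ⟨hgi, hgw⟩ := integral_dual_eq ha hD hρ hopt
  have heq : ∀ᵐ z ∂regionCoupling D ρ a ξ, g z = ‖z.1 - z.2‖ ^ 2 := by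
    have hm : ∀ i, Measurable fun x : Plane => (x, a i) := fun i => by fun_prop
    have hset : MeasurableSet {z : Plane × Plane | g z = ‖z.1 - z.2‖ ^ 2} := by
      refine measurableSet_eq_fun ?_ (by fun_prop)
      exact (((by fun_prop : Continuous fun x : Plane => ‖x‖ ^ 2).sub
        ((continuous_potential ξ).const_mul 2)).measurable.comp measurable_fst).add
        (measurable_targetPotential.comp measurable_snd)
    rw [regionCoupling, Measure.ae_sum_iff]
    intro i
    rw [ae_map_iff (hm i).aemeasurable hset]
    filter_upwards [ae_restrict_mem isOpen_region.measurableSet] with x hx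
    rw [hcost, hg]
    dsimp only
    rw [potential_eq_of_mem hx]
  have hnn : 0 ≤ᵐ[regionCoupling D ρ a ξ] g := heq.mono fun z hz => by
    rw [hz]; exact sq_nonneg _
  have hw0 : 0 ≤ w := by
    rw [hw, ← hgw]
    exact integral_nonneg_of_ae hnn
  have hval : mongeKantorovichSq (densityMeasure D ρ) (massMeasure D ρ a ξ) =
      ENNReal.ofReal w := by
    refine le_antisymm ?_ (le_iInf₂ hlower)
    refine (iInf₂_le _ hopt).trans_eq ?_
    rw [hw, ← hgw, ofReal_integral_eq_lintegral_ofReal hgi hnn]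
    exact lintegral_congr_ae (heq.mono fun z hz => by
      change _ = ENNReal.ofReal (g z)
      rw [hz])
  rw [transportCost, hval, ENNReal.toReal_ofReal hw0]

end Couplings

/-- The target measure is zero. Either the only coupling is zero, or there is none and the infimum
`⊤` has real value 0. -/
theorem transportCost_eq_zero_of_isEmpty [IsEmpty (Fin n)] (ξ : Vec n) :
    transportCost D ρ a ξ = 0 := by
  have hν : massMeasure D ρ a ξ = 0 := by
    rw [massMeasure, Finset.univ_eq_empty, Finset.sum_empty]
  rw [transportCost, hν]
  by_cases h : (couplings (densityMeasure D ρ) 0).Nonempty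
  · obtain ⟨γ, hγ⟩ := h
    have hγ0 : γ = 0 := (Measure.map_eq_zero_iff measurable_snd.aemeasurable).1 hγ.2
    have hle : mongeKantorovichSq (densityMeasure D ρ) 0 ≤ 0 :=
      (iInf₂_le γ hγ).trans_eq (by rw [hγ0, lintegral_zero_measure])
    rw [nonpos_iff_eq_zero.1 hle, ENNReal.toReal_zero]
  · rw [not_nonempty_iff_eq_empty] at h
    simp [mongeKantorovichSq, h]

/-- The transport cost in terms of the mass vector and a function with gradient the negative mass
vector. -/
theorem exists_transportCost_eq (ha : Function.Injective a) (hD : IsConvexPolygon D)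
    (hρ : ContinuousOn ρ D) :
    ∃ K : Vec n → ℝ, (∀ ξ, HasFDerivAt K (-row (massVec D ρ a ξ)) ξ) ∧
      ∀ ξ, transportCost D ρ a ξ = -2 * K ξ + 2 * inner ℝ (halfSq a - ξ) (massVec D ρ a ξ) := by
  rcases isEmpty_or_nonempty (Fin n) with hn | hn
  · refine ⟨0, fun ξ => ?_, fun ξ => ?_⟩
    · refine (hasFDerivAt_const (0 : ℝ) ξ).congr_fderiv ?_
      ext v
      simp [Subsingleton.elim v 0]
    · rw [transportCost_eq_zero_of_isEmpty, Subsingleton.elim (halfSq a - ξ) 0]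
      simp
  -- Half the second moment of the source is absorbed into `K`; it is constant in `ξ`.
  · refine ⟨fun ξ => (∫ x, potential a ξ x ∂densityMeasure D ρ) -
      (∫ x, ‖x‖ ^ 2 ∂densityMeasure D ρ) / 2, fun ξ => ?_, fun ξ => ?_⟩
    · exact (hasFDerivAt_integral_potential ha hD hρ ξ).sub_const _
    · rw [transportCost_eq ha hD hρ]
      ring

theorem contDiff_gradient {g : Vec n → ℝ} (hg : ContDiff ℝ 2 g) : ContDiff ℝ 1 (gradient g) :=
  (InnerProductSpace.toDual ℝ (Vec n)).symm.toContinuousLinearEquiv.contDiff.comp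
    (hg.fderiv_right (m := 1) (by norm_num))

theorem hasFDerivAt_row_gradient {g : Vec n → ℝ} (hg : ContDiff ℝ 2 g) (v : Vec n) :
    HasFDerivAt g (row (gradient g v)) v :=
  ((hg.differentiable (by norm_num)) v).hasGradientAt.hasFDerivAt

theorem contDiff_of_hasFDerivAt_row {K : Vec n → ℝ} {u : Vec n → Vec n} (hu : Continuous u)
    (hK : ∀ ξ, HasFDerivAt K (-row (u ξ)) ξ) : ContDiff ℝ 1 K :=
  contDiff_one_iff_hasFDerivAt.2 ⟨_, ((innerSL ℝ).continuous.comp hu).neg, hK⟩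

theorem exists_seq_hasFDerivAt_massVec (ha : Function.Injective a) (hD : IsConvexPolygon D)
    (hρ : ContinuousOn ρ D) (hρ0 : ∀ x ∈ D, 0 ≤ ρ x) (ξ : Vec n) :
    ∃ y : ℕ → Vec n, Tendsto y atTop (𝓝 ξ) ∧
      ∀ k, HasFDerivAt (massVec D ρ a) (edgeMap D ρ a ξ) (y k) :=
  ⟨fun k => perturb D a ξ (1 / ((k : ℝ) + 1)),
    (tendsto_perturb D a ξ).comp tendsto_one_div_add_atTop_nhds_zero_nat,
    fun _ => hasFDerivAt_massVec_perturb ha hD hρ hρ0 ξ (by positivity)⟩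

end SemiDiscreteOT

/-! ### Assembly of the theorem. -/

open SemiDiscreteOT in
theorem mainTheorem2 {n : ℕ}
    (a : Fin n → SemiDiscreteOT.Plane) (ha : Function.Injective a)
    (D : Set SemiDiscreteOT.Plane) (hD : SemiDiscreteOT.IsConvexPolygon D)
    (g : SemiDiscreteOT.Vec n → ℝ) (hg : ContDiff ℝ 2 g)
    (α : ℝ) (hα : 0 < α)
    (ρ : SemiDiscreteOT.Plane → ℝ) (hρ : ContinuousOn ρ D) (hρ0 : ∀ x ∈ D, 0 ≤ ρ x) :
    (SemiDiscreteOT.IsPC1 (SemiDiscreteOT.objective D ρ a g α) ∧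
      SemiDiscreteOT.IsPC1 (SemiDiscreteOT.residual D ρ a g α) ∧
      SemiDiscreteOT.IsPC1 (SemiDiscreteOT.massVec D ρ a) ∧
      SemiDiscreteOT.IsPC1 (SemiDiscreteOT.transportCost D ρ a)) ∧
    (SemiDiscreteOT.IsSemismooth (SemiDiscreteOT.objective D ρ a g α) ∧
      SemiDiscreteOT.IsSemismooth (SemiDiscreteOT.residual D ρ a g α) ∧
      SemiDiscreteOT.IsSemismooth (SemiDiscreteOT.massVec D ρ a) ∧
      SemiDiscreteOT.IsSemismooth (SemiDiscreteOT.transportCost D ρ a)) ∧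
    ∀ ξ : SemiDiscreteOT.Vec n,
      SemiDiscreteOT.edgeMap D ρ a ξ ∈
        SemiDiscreteOT.clarkeJacobian (SemiDiscreteOT.massVec D ρ a) ξ ∧
      (1 / α) • ((SemiDiscreteOT.hessian g (SemiDiscreteOT.massVec D ρ a ξ)).comp
            (SemiDiscreteOT.edgeMap D ρ a ξ))
          - ContinuousLinearMap.id ℝ (SemiDiscreteOT.Vec n) ∈
        SemiDiscreteOT.clarkeJacobian (SemiDiscreteOT.residual D ρ a g α) ξ ∧
      (SemiDiscreteOT.row ((2 : ℝ) • (SemiDiscreteOT.halfSq a - ξ))).comp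
          (SemiDiscreteOT.edgeMap D ρ a ξ) ∈
        SemiDiscreteOT.clarkeJacobian (SemiDiscreteOT.transportCost D ρ a) ξ ∧
      (SemiDiscreteOT.row (α • SemiDiscreteOT.residual D ρ a g α ξ)).comp
          (SemiDiscreteOT.edgeMap D ρ a ξ) ∈
        SemiDiscreteOT.clarkeJacobian (SemiDiscreteOT.objective D ρ a g α) ξ := by
  have hu := isPC1_massVec ha hD hρ hρ0
  obtain ⟨K, hK, hW⟩ := exists_transportCost_eq (ρ := ρ) ha hD hρ
  have hK1 := contDiff_of_hasFDerivAt_row hu.1 hK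
  have hG := contDiff_gradient hg
  -- In these functions `p.1` stands for `ξ` and `p.2` for the mass vector at `ξ`.
  have hΨr : ContDiff ℝ 1 fun p : Vec n × Vec n =>
      halfSq a + (1 / α) • gradient g p.2 - p.1 :=
    (contDiff_const.add ((hG.comp contDiff_snd).const_smul _)).sub contDiff_fst
  have hΨW : ContDiff ℝ 1 fun p : Vec n × Vec n =>
      -2 * K p.1 + 2 * inner ℝ (halfSq a - p.1) p.2 :=
    (contDiff_const.mul (hK1.comp contDiff_fst)).add
      (contDiff_const.mul ((contDiff_const.sub contDiff_fst).inner ℝ contDiff_snd))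
  have hΨJ : ContDiff ℝ 1 fun p : Vec n × Vec n =>
      g p.2 + α / 2 * (-2 * K p.1 + 2 * inner ℝ (halfSq a - p.1) p.2) :=
    ((hg.of_le (by norm_num)).comp contDiff_snd).add (contDiff_const.mul hΨW)
  have eW : transportCost D ρ a = fun ξ =>
      -2 * K ξ + 2 * inner ℝ (halfSq a - ξ) (massVec D ρ a ξ) := funext hW
  have eJ : objective D ρ a g α = fun ξ => g (massVec D ρ a ξ) +
      α / 2 * (-2 * K ξ + 2 * inner ℝ (halfSq a - ξ) (massVec D ρ a ξ)) := by
    funext ξ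
    rw [objective, hW]
  have pr : IsPC1 (residual D ρ a g α) := hu.comp_graph hΨr
  have pW : IsPC1 (transportCost D ρ a) := eW ▸ hu.comp_graph hΨW
  have pJ : IsPC1 (objective D ρ a g α) := eJ ▸ hu.comp_graph hΨJ
  refine ⟨⟨pJ, pr, hu, pW⟩, ⟨pJ.isSemismooth, pr.isSemismooth, hu.isSemismooth,
    pW.isSemismooth⟩, fun ξ => ?_⟩
  obtain ⟨y, hy, hM⟩ := exists_seq_hasFDerivAt_massVec ha hD hρ hρ0 ξ
  have dfst := hasFDerivAt_fst (𝕜 := ℝ) (p := (ξ, massVec D ρ a ξ))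
  have dsnd := hasFDerivAt_snd (𝕜 := ℝ) (p := (ξ, massVec D ρ a ξ))
  have dW := (((hK ξ).comp (ξ, massVec D ρ a ξ) dfst).const_mul (-2)).add
    (((dfst.const_sub (halfSq a)).inner ℝ dsnd).const_mul 2)
  have dg := (hasFDerivAt_row_gradient hg (massVec D ρ a ξ)).comp (ξ, massVec D ρ a ξ) dsnd
  have dr := (((((hG.differentiable (by norm_num)) (massVec D ρ a ξ)).hasFDerivAt.comp
    (ξ, massVec D ρ a ξ) dsnd).const_smul (1 / α)).const_add (halfSq a)).sub dfst
  refine ⟨?_, ?_, ?_, ?_⟩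
  · exact comp_graph_mem_clarkeJacobian hu.1 contDiff_snd hy hM dsnd
  · exact comp_graph_mem_clarkeJacobian hu.1 hΨr hy hM dr
  · rw [eW]
    -- The two terms that pair the direction with the mass vector, from `K` and from `halfSq a - ξ`,
    -- cancel. What remains is `2 (A - ξ)ᵀ Θ`.
    convert comp_graph_mem_clarkeJacobian hu.1 hΨW hy hM dW using 1
    ext v
    simp [row, fderivInnerCLM_apply, real_inner_comm, inner_sub_left]
    ring
  · rw [eJ]
    -- After the same cancellation the row vector is `∇g + α (A - ξ)`, which is `α r`.
    convert comp_graph_mem_clarkeJacobian hu.1 hΨJ hy hM (dg.add (dW.const_mul (α / 2))) using 1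
    ext v
    simp [row, SemiDiscreteOT.residual, fderivInnerCLM_apply, real_inner_comm, inner_sub_left]
    field_simp
    ring
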